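/- Let $(\Sigma,\sigma)$ be a finite-dimensional real symplectic vector space and let $L(\Sigma)$ be its Lagrangian Grassmannian, i.e. the set of isotropic subspaces of dimension $\tfrac12\dim\Sigma$, with its standard affine charts (a pair of transversal Lagrangian planes $\Delta,\Pi$ gives the chart $\Lambda=\{x+Sx : x\in\Delta\}\mapsto S\in\mathrm{Hom}(\Delta,\Pi)$). For $\Pi,\Lambda_1,\Lambda_2\in L(\Sigma)$ let $q$ be the quadratic form on $((\Lambda_1+\Lambda_2)\cap\Pi)/(\Lambda_1\cap\Pi\cap\Lambda_2)$ given by $q(\lambda_1+\lambda_2)=\sigma(\lambda_1,\lambda_2)$, $\lambda_i\in\Lambda_i$, and let $$\operatorname{ind}_\Pi(\Lambda_1,\Lambda_2)=\operatorname{ind}^+q+\tfrac12\dim\ker q$$ be the positive Maslov index, where $\operatorname{ind}^+q$ is the maximal dimension of a subspace on which $q$ is positive definite. For $T>0$ and a curve $\Lambda:[0,T]\to L(\Sigma)$ put $$\operatorname{ind}_\Pi\Lambda=\sup_{0=t_0<t_1<\dots<t_N=T}\ \sum_{i=0}^{N-1}\operatorname{ind}_\Pi(\Lambda(t_i),\Lambda(t_{i+1}))\in[0,+\infty].$$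 **Theorem.** Let $\Lambda:[0,T]\to L(\Sigma)$ be a differentiable curve (one-sided at the end points). Its derivative $\dot\Lambda(t)$ is the quadratic form on $\Lambda(t)$ with $\dot\Lambda(t)(\lambda(t))=\sigma(\lambda(t),\dot\lambda(t))$ for every curve $\lambda(s)\in\Lambda(s)$ that is differentiable at $t$. Then $\Lambda$ is monotone increasing, i.e. $\dot\Lambda(t)\ge 0$ as a quadratic form on $\Lambda(t)$ for every $t\in[0,T]$, if and only if $\operatorname{ind}_\Pi\Lambda<+\infty$ for some $\Pi\in L(\Sigma)$. -/

import Mathlib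

open Set Filter Topology

namespace MaslovMonotone

/-- A symplectic form on a real vector space: a nondegenerate alternating bilinear form. -/
structure IsSymplectic {V : Type*} [AddCommGroup V] [Module ℝ V]
    (σ : LinearMap.BilinForm ℝ V) : Prop where
  alt : σ.IsAlt
  nondegenerate : σ.Nondegenerate

/-- A point of the Lagrangian Grassmannian `L(Σ)`: an isotropic subspace of half the dimension. -/
structure LagrangianGrassmannian {V : Type*} [AddCommGroup V] [Module ℝ V]
    (σ : LinearMap.BilinForm ℝ V) where
  toSubmodule : Submodule ℝ V
  isotropic : ∀ x ∈ toSubmodule, ∀ y ∈ toSubmodule, σ x y = 0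
  two_mul_finrank : 2 * Module.finrank ℝ toSubmodule = Module.finrank ℝ V

section Index

variable {V : Type*} [AddCommGroup V] [Module ℝ V] {σ : LinearMap.BilinForm ℝ V}

/-- The subspace `(Λ₁ + Λ₂) ∩ Π`. -/
def sumInf (P L₁ L₂ : LagrangianGrassmannian σ) : Submodule ℝ V :=
  (L₁.toSubmodule ⊔ L₂.toSubmodule) ⊓ P.toSubmodule

/-- The subspace `Λ₁ ∩ Π ∩ Λ₂`, regarded as a subspace of `(Λ₁ + Λ₂) ∩ Π`. -/
def tripleInf (P L₁ L₂ : LagrangianGrassmannian σ) : Submodule ℝ (sumInf P L₁ L₂) :=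
  (L₁.toSubmodule ⊓ P.toSubmodule ⊓ L₂.toSubmodule).submoduleOf (sumInf P L₁ L₂)

/-- The quotient `((Λ₁ + Λ₂) ∩ Π) / (Λ₁ ∩ Π ∩ Λ₂)`. -/
abbrev MaslovSpace (P L₁ L₂ : LagrangianGrassmannian σ) : Type _ :=
  sumInf P L₁ L₂ ⧸ tripleInf P L₁ L₂

/-- The class of `λ₁ + λ₂ ∈ Π`, with `λ₁ ∈ Λ₁` and `λ₂ ∈ Λ₂`, in the quotient
`((Λ₁ + Λ₂) ∩ Π) / (Λ₁ ∩ Π ∩ Λ₂)`. -/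
def maslovClass (P L₁ L₂ : LagrangianGrassmannian σ) (x₁ x₂ : V)
    (h₁ : x₁ ∈ L₁.toSubmodule) (h₂ : x₂ ∈ L₂.toSubmodule) (h : x₁ + x₂ ∈ P.toSubmodule) :
    MaslovSpace P L₁ L₂ :=
  (tripleInf P L₁ L₂).mkQ ⟨x₁ + x₂, Submodule.add_mem_sup h₁ h₂, h⟩

/-- The quadratic form `q(λ₁ + λ₂) = σ(λ₁, λ₂)` is well defined on
`((Λ₁ + Λ₂) ∩ Π) / (Λ₁ ∩ Π ∩ Λ₂)`, and it is determined by this formula. -/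
theorem existsUnique_maslovForm (P L₁ L₂ : LagrangianGrassmannian σ) :
    ∃! q : QuadraticForm ℝ (MaslovSpace P L₁ L₂),
      ∀ (x₁ x₂ : V) (h₁ : x₁ ∈ L₁.toSubmodule) (h₂ : x₂ ∈ L₂.toSubmodule)
        (h : x₁ + x₂ ∈ P.toSubmodule), q (maslovClass P L₁ L₂ x₁ x₂ h₁ h₂ h) = σ x₁ x₂ := by
  have hrep : ∀ x : MaslovSpace P L₁ L₂, ∃ (x₁ x₂ : V) (h₁ : x₁ ∈ L₁.toSubmodule)
      (h₂ : x₂ ∈ L₂.toSubmodule) (h : x₁ + x₂ ∈ P.toSubmodule),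
      maslovClass P L₁ L₂ x₁ x₂ h₁ h₂ h = x := by
    intro x
    obtain ⟨⟨w, hw, hwP⟩, rfl⟩ := (tripleInf P L₁ L₂).mkQ_surjective x
    obtain ⟨x₁, h₁, x₂, h₂, rfl⟩ := Submodule.mem_sup.1 hw
    exact ⟨x₁, x₂, h₁, h₂, hwP, rfl⟩
  let D : Submodule ℝ (L₁.toSubmodule × L₂.toSubmodule) :=
    P.toSubmodule.comap (L₁.toSubmodule.subtype.coprod L₂.toSubmodule.subtype)
  let f₀ : D →ₗ[ℝ] sumInf P L₁ L₂ :=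
    LinearMap.codRestrict (sumInf P L₁ L₂)
      ((L₁.toSubmodule.subtype.coprod L₂.toSubmodule.subtype) ∘ₗ D.subtype)
      (fun d => ⟨Submodule.add_mem_sup d.1.1.2 d.1.2.2, d.2⟩)
  let f : D →ₗ[ℝ] MaslovSpace P L₁ L₂ := (tripleInf P L₁ L₂).mkQ ∘ₗ f₀
  have hf : Function.Surjective f := by
    intro x
    obtain ⟨x₁, x₂, h₁, h₂, h, rfl⟩ := hrep x
    exact ⟨⟨(⟨x₁, h₁⟩, ⟨x₂, h₂⟩), h⟩, rfl⟩
  obtain ⟨g, hg⟩ := f.exists_rightInverse_of_surjective (LinearMap.range_eq_top.2 hf)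
  let p₁ : MaslovSpace P L₁ L₂ →ₗ[ℝ] V :=
    L₁.toSubmodule.subtype ∘ₗ LinearMap.fst ℝ _ _ ∘ₗ D.subtype ∘ₗ g
  let p₂ : MaslovSpace P L₁ L₂ →ₗ[ℝ] V :=
    L₂.toSubmodule.subtype ∘ₗ LinearMap.snd ℝ _ _ ∘ₗ D.subtype ∘ₗ g
  let B : LinearMap.BilinForm ℝ (MaslovSpace P L₁ L₂) := σ.compl₁₂ p₁ p₂
  refine ⟨B.toQuadraticMap, ?_, ?_⟩
  · intro x₁ x₂ h₁ h₂ h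
    set x := maslovClass P L₁ L₂ x₁ x₂ h₁ h₂ h with hx
    have hp₁ : p₁ x ∈ L₁.toSubmodule := (g x).1.1.2
    have hp₂ : p₂ x ∈ L₂.toSubmodule := (g x).1.2.2
    have hgx : f (g x) = x := LinearMap.congr_fun hg x
    have hk : (x₁ + x₂) - (p₁ x + p₂ x) ∈
        L₁.toSubmodule ⊓ P.toSubmodule ⊓ L₂.toSubmodule := by
      have := (Submodule.Quotient.eq (tripleInf P L₁ L₂)).1 (hx.symm.trans hgx.symm)
      exact this
    obtain ⟨⟨hk₁, -⟩, hk₂⟩ := hk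
    have hu₁ : x₁ - p₁ x ∈ L₁.toSubmodule := sub_mem h₁ hp₁
    have hv₂ : x₂ - p₂ x ∈ L₂.toSubmodule := sub_mem h₂ hp₂
    have hu₂ : x₁ - p₁ x ∈ L₂.toSubmodule := by
      have := sub_mem hk₂ hv₂
      convert this using 1; abel
    have hv₁ : x₂ - p₂ x ∈ L₁.toSubmodule := by
      have := sub_mem hk₁ hu₁
      convert this using 1; abel
    have e₁ := L₁.isotropic _ h₁ _ hv₁
    have e₂ := L₂.isotropic _ hu₂ _ hp₂
    have : B.toQuadraticMap x = σ (p₁ x) (p₂ x) := rfl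
    rw [this]
    simp only [map_sub, LinearMap.sub_apply] at e₁ e₂
    linarith
  · intro q hq
    ext x
    obtain ⟨x₁, x₂, h₁, h₂, h, rfl⟩ := hrep x
    rw [hq]
    set x := maslovClass P L₁ L₂ x₁ x₂ h₁ h₂ h with hx
    have hp₁ : p₁ x ∈ L₁.toSubmodule := (g x).1.1.2
    have hp₂ : p₂ x ∈ L₂.toSubmodule := (g x).1.2.2
    have hgx : f (g x) = x := LinearMap.congr_fun hg x
    have hP : p₁ x + p₂ x ∈ P.toSubmodule := (g x).2
    have h3 := hq (p₁ x) (p₂ x) hp₁ hp₂ hP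
    have h4 : maslovClass P L₁ L₂ (p₁ x) (p₂ x) hp₁ hp₂ hP = x := hgx
    rw [h4, hx, hq] at h3
    exact h3

/-- The quadratic form `q` on `((Λ₁ + Λ₂) ∩ Π) / (Λ₁ ∩ Π ∩ Λ₂)` given by
`q(λ) = σ(λ₁, λ₂)` for `λ = λ₁ + λ₂` with `λᵢ ∈ Λᵢ`. -/
noncomputable def maslovForm (P L₁ L₂ : LagrangianGrassmannian σ) :
    QuadraticForm ℝ (MaslovSpace P L₁ L₂) :=
  (existsUnique_maslovForm P L₁ L₂).choose

theorem maslovForm_apply (P L₁ L₂ : LagrangianGrassmannian σ) (x₁ x₂ : V)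
    (h₁ : x₁ ∈ L₁.toSubmodule) (h₂ : x₂ ∈ L₂.toSubmodule) (h : x₁ + x₂ ∈ P.toSubmodule) :
    maslovForm P L₁ L₂ (maslovClass P L₁ L₂ x₁ x₂ h₁ h₂ h) = σ x₁ x₂ :=
  (existsUnique_maslovForm P L₁ L₂).choose_spec.1 x₁ x₂ h₁ h₂ h

/-- The positive Maslov index `ind_Π(Λ₁, Λ₂) = ind⁺ q + (1/2) dim ker q`, where `ind⁺` is the
maximal dimension of a subspace on which the form is positive definite. -/
noncomputable def maslovIndex (P L₁ L₂ : LagrangianGrassmannian σ) : ℝ :=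
  sigPos (maslovForm P L₁ L₂) + (1 / 2) * Module.finrank ℝ (maslovForm P L₁ L₂).radical

/-- A partition `0 = t₀ < t₁ < ⋯ < t_N = T` of `[0, T]`. -/
structure IntervalPartition (T : ℝ) where
  N : ℕ
  pts : Fin (N + 1) → ℝ
  strictMono : StrictMono pts
  first : pts 0 = 0
  last : pts (Fin.last N) = T

/-- `ind_Π^D Λ`: the sum over a partition `D` of the positive Maslov indices
`ind_Π(Λ(tᵢ), Λ(tᵢ₊₁))`. -/
noncomputable def partitionIndex (P : LagrangianGrassmannian σ)
    (L : ℝ → LagrangianGrassmannian σ) {T : ℝ} (D : IntervalPartition T) : ℝ :=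
  ∑ i : Fin D.N, maslovIndex P (L (D.pts i.castSucc)) (L (D.pts i.succ))

/-- `ind_Π Λ = sup_D ind_Π^D Λ`, the supremum over all partitions of `[0, T]`, as an extended
real number. -/
noncomputable def curveIndex (P : LagrangianGrassmannian σ)
    (L : ℝ → LagrangianGrassmannian σ) (T : ℝ) : EReal :=
  ⨆ D : IntervalPartition T, ((partitionIndex P L D : ℝ) : EReal)

end Index

section Curves

variable {V : Type*} [NormedAddCommGroup V] [NormedSpace ℝ V] {σ : LinearMap.BilinForm ℝ V}

/-- The graph `{x + S x | x ∈ Δ}` of a linear map `S : Δ → Π`. -/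
def graphOver {E P : Submodule ℝ V} (S : E →L[ℝ] P) : Submodule ℝ V :=
  LinearMap.range (E.subtype + P.subtype ∘ₗ (S : E →ₗ[ℝ] P))

/-- Differentiability at `t`, within `I`, of a curve in the Lagrangian Grassmannian: for `s ∈ I`
near `t` the curve stays in an affine chart, i.e. `Λ(s)` is the graph of a linear map
`S(s) : Δ → Π` for a pair `Δ`, `Π` of transversal Lagrangian planes, and the coordinate `S` is
differentiable at `t` within `I`. -/
def CurveDifferentiableWithinAt (L : ℝ → LagrangianGrassmannian σ) (I : Set ℝ) (t : ℝ) : Prop :=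
  ∃ E P : LagrangianGrassmannian σ, IsCompl E.toSubmodule P.toSubmodule ∧
    ∃ S : ℝ → (E.toSubmodule →L[ℝ] P.toSubmodule),
      DifferentiableWithinAt ℝ S I t ∧ ∀ᶠ s in 𝓝[I] t, (L s).toSubmodule = graphOver (S s)

/-- A curve in the Lagrangian Grassmannian is differentiable on `I`. -/
def CurveDifferentiableOn (L : ℝ → LagrangianGrassmannian σ) (I : Set ℝ) : Prop :=
  ∀ t ∈ I, CurveDifferentiableWithinAt L I t

/-- `q` is the derivative `Λ'(t)`, regarded as a quadratic form on `Λ(t)`: for every curve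
`ℓ(s) ∈ Λ(s)`, `s ∈ I`, that is differentiable at `t`, one has `q(ℓ(t)) = σ(ℓ(t), ℓ'(t))`. -/
def IsVelocityForm (L : ℝ → LagrangianGrassmannian σ) (I : Set ℝ) (t : ℝ)
    (q : QuadraticForm ℝ (L t).toSubmodule) : Prop :=
  ∀ (ℓ : ℝ → V) (v : V), (∀ s ∈ I, ℓ s ∈ (L s).toSubmodule) → HasDerivWithinAt ℓ v I t →
    ∀ x : (L t).toSubmodule, ℓ t = x → q x = σ x v

/-- Consistency of the definition: a differentiable curve has exactly one velocity form. -/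
theorem existsUnique_isVelocityForm [FiniteDimensional ℝ V]
    (L : ℝ → LagrangianGrassmannian σ) (I : Set ℝ) (t : ℝ) (ht : t ∈ I)
    (hI : UniqueDiffWithinAt ℝ I t) (hL : CurveDifferentiableWithinAt L I t) :
    ∃! q : QuadraticForm ℝ (L t).toSubmodule, IsVelocityForm L I t q := by
  obtain ⟨E, P, hEP, S, hS, hgr⟩ := hL
  have hgt : (L t).toSubmodule = graphOver (S t) := hgr.self_of_nhdsWithin ht
  let p : V →L[ℝ] E.toSubmodule :=
    LinearMap.toContinuousLinearMap (Submodule.projectionOnto _ _ hEP)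
  have hpE : ∀ x : E.toSubmodule, p x = x := fun x => Submodule.projectionOnto_apply_left hEP x
  have hpP : ∀ y : P.toSubmodule, p y = 0 := fun y => Submodule.projectionOnto_apply_right hEP y
  have hrep : ∀ s x, (L s).toSubmodule = graphOver (S s) → x ∈ (L s).toSubmodule →
      x = (p x : V) + (S s (p x) : V) := by
    intro s x hs hx
    rw [hs] at hx
    obtain ⟨a, rfl⟩ := hx
    simp [hpE, hpP]
  have hmem : ∀ s (a : E.toSubmodule), (L s).toSubmodule = graphOver (S s) →
      (a : V) + (S s a : V) ∈ (L s).toSubmodule := by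
    intro s a hs
    rw [hs]
    exact ⟨a, rfl⟩
  obtain ⟨S', hd⟩ : ∃ S', HasDerivWithinAt S S' I t :=
    ⟨_, HasFDerivWithinAt.hasDerivWithinAt (DifferentiableWithinAt.hasFDerivWithinAt hS)⟩
  have hcurve : ∀ (a : ℝ → E.toSubmodule) (a' : E.toSubmodule), HasDerivWithinAt a a' I t →
      HasDerivWithinAt (fun s => (a s : V) + (S s (a s) : V))
        ((a' : V) + ((S' (a t) + S t a' : P.toSubmodule) : V)) I t := by
    intro a a' ha
    have h1 : HasDerivWithinAt (fun s => (a s : V)) (a' : V) I t :=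
      (E.toSubmodule.subtypeL.hasFDerivAt.comp_hasDerivWithinAt t ha)
    have h2 : HasDerivWithinAt (fun s => S s (a s)) (S' (a t) + S t a') I t := hd.clm_apply ha
    have h3 : HasDerivWithinAt (fun s => (S s (a s) : V))
        ((S' (a t) + S t a' : P.toSubmodule) : V) I t :=
      (P.toSubmodule.subtypeL.hasFDerivAt.comp_hasDerivWithinAt t h2)
    exact h1.add h3
  let B : LinearMap.BilinForm ℝ (L t).toSubmodule :=
    σ.compl₁₂ (L t).toSubmodule.subtype
      (P.toSubmodule.subtype ∘ₗ (S' : E.toSubmodule →ₗ[ℝ] P.toSubmodule) ∘ₗ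
        (p : V →ₗ[ℝ] E.toSubmodule) ∘ₗ (L t).toSubmodule.subtype)
  refine ⟨B.toQuadraticMap, ?_, ?_⟩
  · intro ℓ v hℓ hv x hx
    have ha : HasDerivWithinAt (fun s => p (ℓ s)) (p v) I t :=
      p.hasFDerivAt.comp_hasDerivWithinAt t hv
    have h1 := hcurve _ _ ha
    have h2 : HasDerivWithinAt ℓ
        ((p v : V) + ((S' (p (ℓ t)) + S t (p v) : P.toSubmodule) : V)) I t := by
      refine h1.congr_of_eventuallyEq ?_ (hrep t _ hgt (hℓ t ht))
      filter_upwards [hgr, self_mem_nhdsWithin] with s hs hsI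
      exact hrep s _ hs (hℓ s hsI)
    have hveq := hI.eq_deriv I hv h2
    have h0 := (L t).isotropic x x.2 _ (hmem t (p v) hgt)
    have hB : B.toQuadraticMap x = σ x (S' (p x) : V) := rfl
    rw [hB, hveq, hx]
    simp only [Submodule.coe_add, map_add] at h0 ⊢
    linarith
  · intro q hq
    ext x
    classical
    let a : E.toSubmodule := p x
    let ℓ : ℝ → V := fun s =>
      if (L s).toSubmodule = graphOver (S s) then (a : V) + (S s a : V) else 0
    have hℓ : ∀ s ∈ I, ℓ s ∈ (L s).toSubmodule := by
      intro s _
      by_cases hs : (L s).toSubmodule = graphOver (S s)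
      · simpa [ℓ, hs] using (hs ▸ hmem s a hs)
      · simp [ℓ, hs]
    have hxt : ℓ t = x := by
      simp only [ℓ, if_pos hgt]
      exact (hrep t x hgt x.2).symm
    have h1 := hcurve (fun _ => a) 0 (hasDerivWithinAt_const _ _ _)
    have h2 : HasDerivWithinAt ℓ
        (((0 : E.toSubmodule) : V) + ((S' a + S t 0 : P.toSubmodule) : V)) I t := by
      refine h1.congr_of_eventuallyEq ?_ (if_pos hgt)
      filter_upwards [hgr] with s hs
      exact if_pos hs
    have h3 := hq ℓ _ hℓ h2 x hxt
    have hB : B.toQuadraticMap x = σ x (S' (p x) : V) := rfl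
    rw [h3, hB]
    simp [a]

/-- The curve is monotone increasing on `I`: at every time, the derivative `Λ'(t)` is a
nonnegative quadratic form on `Λ(t)`. -/
def IsMonotoneIncreasingOn (L : ℝ → LagrangianGrassmannian σ) (I : Set ℝ) : Prop :=
  ∀ t ∈ I, ∃ q : QuadraticForm ℝ (L t).toSubmodule,
    IsVelocityForm L I t q ∧ ∀ x : (L t).toSubmodule, 0 ≤ q x

end Curves

end MaslovMonotone

/-! The idea is to use charts whose domain is the reference plane Π itself. If P is a Lagrangian
complement of both Π and Λ(t), then the planes Λ(s) near t are graphs of maps S(s) : Π → P. They are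
encoded by the symmetric forms B_s(x, y) = σ(x, S(s) y) on Π, and the velocity form becomes the
derivative of B_s (`IsVelocityForm.apply_chart`). Vanishing of the index turns into a condition on
two forms (`maslovIndex_eq_zero_iff_isNegativeCoupling`).

The crux is that for B₁, B₂ with the same positive and negative indices, this condition is
equivalent to B₁ ≤ B₂ (`isNegativeCoupling_of_le`, `le_of_isNegativeCoupling`). Both directions are
dimension counts for F(x, y) = B₂(y, y) - B₁(x, x) on Π × Π. On the antidiagonal {(-u, u)} the form
F is B₂ - B₁; on its F-orthogonal {B₁ x + B₂ y = 0} it is the pull-back of the Maslov form q.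

If the curve is monotone, B_s increases in s, so a nonzero index forces a jump of the signature. The
signature is bounded and monotone, hence index sums over a chart interval are bounded, and
compactness of [0, T] reduces to finitely many charts. Conversely, if the velocity is negative on
some vector a, then B_s(a, a) decreases along arbitrarily long chains of times. By pigeonhole these
may be taken with constant signature; every step then has nonzero index, hence index at least 1/2,
and the sums are unbounded. -/

namespace MaslovMonotone

/-! ### Signatures of pairs of symmetric forms. -/

section Signature

variable {E : Type*} [AddCommGroup E] [Module ℝ E] [FiniteDimensional ℝ E]

open Module

theorem finrank_submodule_prod (p q : Submodule ℝ E) :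
    finrank ℝ (p.prod q) = finrank ℝ p + finrank ℝ q := by
  have h : LinearMap.range (p.subtype.prodMap q.subtype) = p.prod q := by
    rw [LinearMap.range_prodMap, Submodule.range_subtype, Submodule.range_subtype]
  rw [← h, LinearMap.finrank_range_of_inj, finrank_prod]
  rw [LinearMap.coe_prodMap]
  exact p.subtype_injective.prodMap q.subtype_injective

/-- A subspace of `E × E` on which `B₂(y, y) - B₁(x, x)` is nonpositive has dimension at most
`2 dim E - ind⁺ B₂ - ind⁻ B₁`. -/
theorem finrank_add_sigPos_add_sigNeg_le (B₁ B₂ : LinearMap.BilinForm ℝ E)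
    (U : Submodule ℝ (E × E)) (hU : ∀ v ∈ U, B₂ v.2 v.2 - B₁ v.1 v.1 ≤ 0) :
    finrank ℝ U + sigPos B₂.toQuadraticMap + sigNeg B₁.toQuadraticMap ≤ 2 * finrank ℝ E := by
  obtain ⟨W₁, h₁, hW₁⟩ := exists_finrank_eq_sigNeg_and_negDef B₁.toQuadraticMap
  obtain ⟨W₂, h₂, hW₂⟩ := exists_finrank_eq_sigPos_and_posDef B₂.toQuadraticMap
  -- The form is positive on W₁ × W₂ off zero, so that product meets U trivially.
  have hd : Disjoint U (W₁.prod W₂) := by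
    rw [Submodule.disjoint_def]
    rintro ⟨x, y⟩ hv ⟨hx, hy⟩
    have h0 := hU _ hv
    have e₁ : x ≠ 0 → 0 < -B₁ x x := fun h => by
      simpa using hW₁ ⟨x, hx⟩ (by simpa using h)
    have e₂ : y ≠ 0 → 0 < B₂ y y := fun h => by
      simpa using hW₂ ⟨y, hy⟩ (by simpa using h)
    by_cases hx0 : x = 0
    · by_cases hy0 : y = 0
      · simp [hx0, hy0]
      · have := e₂ hy0
        simp only [hx0, map_zero] at h0
        linarith
    · have := e₁ hx0
      by_cases hy0 : y = 0
      · simp only [hy0, map_zero] at h0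
        linarith
      · have := e₂ hy0
        simp only at h0
        linarith
  have h := Submodule.finrank_add_finrank_le_of_disjoint hd
  have hp : finrank ℝ (W₁.prod W₂) = finrank ℝ W₁ + finrank ℝ W₂ :=
    finrank_submodule_prod W₁ W₂
  rw [finrank_prod, hp] at h
  omega

omit [FiniteDimensional ℝ E] in
theorem toQuadraticMap_neg (B : LinearMap.BilinForm ℝ E) :
    (-B).toQuadraticMap = -B.toQuadraticMap := by
  ext; simp

theorem finrank_add_sigNeg_add_sigPos_le (B₁ B₂ : LinearMap.BilinForm ℝ E)
    (U : Submodule ℝ (E × E)) (hU : ∀ v ∈ U, 0 ≤ B₂ v.2 v.2 - B₁ v.1 v.1) :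
    finrank ℝ U + sigNeg B₂.toQuadraticMap + sigPos B₁.toQuadraticMap ≤ 2 * finrank ℝ E := by
  have := finrank_add_sigPos_add_sigNeg_le (-B₁) (-B₂) U (fun v hv => by
    have := hU v hv
    simp only [LinearMap.neg_apply]
    linarith)
  simpa [toQuadraticMap_neg] using this

omit [FiniteDimensional ℝ E] in
theorem radical_toQuadraticMap (B : LinearMap.BilinForm ℝ E) (hB : ∀ x y, B x y = B y x) :
    B.toQuadraticMap.radical = LinearMap.ker B := by
  ext x
  rw [QuadraticMap.radical_eq_ker_associated, LinearMap.mem_ker, LinearMap.mem_ker]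
  rw [QuadraticMap.associated_left_inverse ℝ (fun x y => by simp [hB x y])]

theorem sigPos_add_sigNeg_add_finrank_ker (B : LinearMap.BilinForm ℝ E)
    (hB : ∀ x y, B x y = B y x) :
    sigPos B.toQuadraticMap + sigNeg B.toQuadraticMap + finrank ℝ (LinearMap.ker B)
      = finrank ℝ E := by
  rw [← radical_toQuadraticMap B hB]
  exact QuadraticForm.sigPos_add_sigNeg_add_radical

/-- The form `(x, y) ↦ B₂(y, y) - B₁(x, x)`, restricted to `{B₁ x + B₂ y = 0}`, is negative apart
from its values at the vectors with `x + y` in the kernels. -/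
def IsNegativeCoupling (B₁ B₂ : LinearMap.BilinForm ℝ E) : Prop :=
  ∀ x y, B₁ x + B₂ y = 0 → B₂ y y - B₁ x x < 0 ∨ (B₁ (x + y) = 0 ∧ B₂ (x + y) = 0)

/-- With F(x, y) = B₂(y, y) - B₁(x, x), the sum of the antidiagonal and K₁ × K₂ (the two kernels) is
F-nonnegative and already has the largest dimension the signatures allow. A vector of {B₁ x + B₂ y =
0} is F-orthogonal to this sum, so if F is nonnegative at it, it can be adjoined; it must then lie
in the sum already. -/
theorem isNegativeCoupling_of_le (B₁ B₂ : LinearMap.BilinForm ℝ E)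
    (hB₁ : ∀ x y, B₁ x y = B₁ y x) (hB₂ : ∀ x y, B₂ x y = B₂ y x)
    (hpos : sigPos B₁.toQuadraticMap = sigPos B₂.toQuadraticMap)
    (hneg : sigNeg B₁.toQuadraticMap = sigNeg B₂.toQuadraticMap)
    (hle : ∀ x, B₁ x x ≤ B₂ x x) : IsNegativeCoupling B₁ B₂ := by
  intro x y hxy
  by_contra! hcon
  obtain ⟨hF, hK⟩ := hcon
  have d₁ := sigPos_add_sigNeg_add_finrank_ker B₁ hB₁
  have d₂ := sigPos_add_sigNeg_add_finrank_ker B₂ hB₂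
  set K₁ := LinearMap.ker B₁
  set K₂ := LinearMap.ker B₂
  let δ : E →ₗ[ℝ] E × E := (-LinearMap.id).prod LinearMap.id
  have hδ : Function.Injective δ := fun a b h => (Prod.ext_iff.1 h).2
  let U : Submodule ℝ (E × E) := LinearMap.range δ ⊔ K₁.prod K₂
  have hUrep : ∀ v ∈ U, ∃ u k₁ k₂, B₁ k₁ = 0 ∧ B₂ k₂ = 0 ∧ v = (-u + k₁, u + k₂) := by
    intro v hv
    obtain ⟨_, ⟨u, rfl⟩, k, ⟨hk₁, hk₂⟩, rfl⟩ := Submodule.mem_sup.1 hv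
    exact ⟨u, k.1, k.2, hk₁, hk₂, rfl⟩
  -- The cross terms vanish: kernel vectors contribute nothing, and B₁ x + B₂ y = 0 is orthogonality
  -- to the antidiagonal. What remains is (B₂ - B₁)(u, u) + c² F(x, y).
  have hUF : ∀ v ∈ U ⊔ Submodule.span ℝ {(x, y)}, 0 ≤ B₂ v.2 v.2 - B₁ v.1 v.1 := by
    intro v hv
    obtain ⟨w, hw, z, hz, rfl⟩ := Submodule.mem_sup.1 hv
    obtain ⟨c, rfl⟩ := Submodule.mem_span_singleton.1 hz
    obtain ⟨u, k₁, k₂, hk₁, hk₂, rfl⟩ := hUrep w hw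
    have a₁ : ∀ z, B₁ z k₁ = 0 := fun z => by rw [hB₁, hk₁]; rfl
    have a₂ : ∀ z, B₂ z k₂ = 0 := fun z => by rw [hB₂, hk₂]; rfl
    have a₃ : B₁ x u + B₂ y u = 0 := by
      rw [← LinearMap.add_apply, hxy]; rfl
    have a₄ := hle u
    simp only [Prod.smul_mk, Prod.mk_add_mk, map_add, map_neg, map_smul, LinearMap.add_apply,
      LinearMap.neg_apply, LinearMap.smul_apply, smul_eq_mul, a₁, a₂, hk₁, hk₂,
      LinearMap.zero_apply]
    rw [hB₁ u x, hB₂ u y, eq_neg_of_add_eq_zero_right a₃]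
    nlinarith [mul_nonneg (mul_self_nonneg c) hF]
  have hb := finrank_add_sigNeg_add_sigPos_le B₁ B₂ _ hUF
  have hU0 : U ≤ U ⊔ Submodule.span ℝ {(x, y)} := le_sup_left
  have hm := Submodule.finrank_mono hU0
  have hs := Submodule.finrank_sup_add_finrank_inf_eq (LinearMap.range δ) (K₁.prod K₂)
  have hi : LinearMap.range δ ⊓ K₁.prod K₂ ≤ (K₁ ⊓ K₂).map δ := by
    rintro _ ⟨⟨u, rfl⟩, h1, h2⟩
    exact ⟨u, ⟨by simpa [δ] using h1, h2⟩, rfl⟩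
  have hi' := (Submodule.finrank_mono hi).trans (Submodule.finrank_map_le δ (K₁ ⊓ K₂))
  have hr : finrank ℝ (LinearMap.range δ) = finrank ℝ E := LinearMap.finrank_range_of_inj hδ
  have hp : finrank ℝ (K₁.prod K₂) = finrank ℝ K₁ + finrank ℝ K₂ :=
    finrank_submodule_prod K₁ K₂
  have hi₁ : finrank ℝ ↥(K₁ ⊓ K₂) ≤ finrank ℝ K₁ := Submodule.finrank_mono inf_le_left
  have hUd : finrank ℝ U = finrank ℝ ↥(LinearMap.range δ ⊔ K₁.prod K₂) := rfl
  -- Equal signatures give dim K₁ = dim K₂, and the bound reads dim E + dim K₁, while dim U ≥ dim E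
  -- + dim K₁ + dim K₂ - dim (K₁ ∩ K₂). Equality is forced everywhere.
  have e₁ : K₁ ⊓ K₂ = K₁ := Submodule.eq_of_le_of_finrank_le inf_le_left (by omega)
  have e₂ : K₁ ⊓ K₂ = K₂ := Submodule.eq_of_le_of_finrank_le inf_le_right (by omega)
  have e₃ : U = U ⊔ Submodule.span ℝ {(x, y)} :=
    Submodule.eq_of_le_of_finrank_le hU0 (by omega)
  have hvU : (x, y) ∈ U := by
    rw [e₃]
    exact Submodule.mem_sup_right (Submodule.mem_span_singleton_self _)
  obtain ⟨u, k₁, k₂, hk₁, hk₂, h⟩ := hUrep _ hvU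
  have hsum : x + y = k₁ + k₂ := by
    obtain ⟨rfl, rfl⟩ := Prod.mk.inj h
    abel
  have m₁ : k₁ ∈ K₂ := (e₁.symm.le.trans inf_le_right) hk₁
  have m₂ : k₂ ∈ K₁ := (e₂.symm.le.trans inf_le_left) hk₂
  refine hK ?_ ?_
  · rw [hsum, map_add, hk₁, zero_add]; exact m₂
  · rw [hsum, map_add, hk₂, add_zero]; exact m₁

/-- Coupling makes F(x, y) = B₂(y, y) - B₁(x, x) nonpositive on {B₁ x + B₂ y = 0}, which already
reaches the maximal dimension of an F-nonpositive subspace. A vector u violating the inequality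
would make F negative at (-u, u), which is orthogonal to this space and outside it, so the space
could be enlarged. -/
theorem le_of_isNegativeCoupling (B₁ B₂ : LinearMap.BilinForm ℝ E)
    (hB₁ : ∀ x y, B₁ x y = B₁ y x) (hB₂ : ∀ x y, B₂ x y = B₂ y x)
    (hpos : sigPos B₁.toQuadraticMap = sigPos B₂.toQuadraticMap)
    (hneg : sigNeg B₁.toQuadraticMap = sigNeg B₂.toQuadraticMap)
    (h : IsNegativeCoupling B₁ B₂) (u : E) : B₁ u u ≤ B₂ u u := by
  by_contra! hu
  have d₁ := sigPos_add_sigNeg_add_finrank_ker B₁ hB₁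
  have d₂ := sigPos_add_sigNeg_add_finrank_ker B₂ hB₂
  set K₁ := LinearMap.ker B₁
  set K₂ := LinearMap.ker B₂
  -- Coupling at (x, 0) with x in K₁: the strict alternative would read 0 < 0.
  have hK : K₁ ≤ K₂ := by
    intro x hx
    have hx' : B₁ x = 0 := hx
    rcases h x 0 (by simp [hx']) with h1 | h1
    · simp [hx'] at h1
    · simpa [K₂] using h1.2
  let f : E × E →ₗ[ℝ] Dual ℝ E := B₁.coprod B₂
  have hf : ∀ x y, f (x, y) = B₁ x + B₂ y := fun x y => by simp [f]
  -- This bounds the rank of f by dim E - dim K₁, so dim ker f ≥ dim E + dim K₁.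
  have hrange : LinearMap.range f ≤ K₁.dualAnnihilator := by
    rintro _ ⟨⟨x, y⟩, rfl⟩
    rw [Submodule.mem_dualAnnihilator]
    intro w hw
    have w₁ : B₁ w = 0 := hw
    have w₂ : B₂ w = 0 := hK hw
    rw [hf, LinearMap.add_apply, hB₁, hB₂, w₁, w₂]
    simp
  have hr := Submodule.finrank_mono hrange
  have ha := Subspace.finrank_add_finrank_dualAnnihilator_eq K₁
  have hrn := f.finrank_range_add_finrank_ker
  rw [finrank_prod] at hrn
  let U := LinearMap.ker f ⊔ Submodule.span ℝ {((-u, u) : E × E)}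
  have hdU : (-u, u) ∈ U := Submodule.mem_sup_right (Submodule.mem_span_singleton_self _)
  have hUF : ∀ v ∈ U, B₂ v.2 v.2 - B₁ v.1 v.1 ≤ 0 := by
    intro v hv
    obtain ⟨⟨x, y⟩, hw, z, hz, rfl⟩ := Submodule.mem_sup.1 hv
    obtain ⟨c, rfl⟩ := Submodule.mem_span_singleton.1 hz
    have hxy : B₁ x + B₂ y = 0 := (hf x y).symm.trans hw
    have a₃ : ∀ u, B₁ x u + B₂ y u = 0 := fun u => by
      rw [← LinearMap.add_apply, hxy]; rfl
    have hF : B₂ y y - B₁ x x ≤ 0 := by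
      rcases h x y hxy with h1 | ⟨h1, h2⟩
      · exact h1.le
      · have b₁ := LinearMap.congr_fun h1 x
        have b₂ := LinearMap.congr_fun h2 y
        have b₃ := a₃ x
        have b₄ := a₃ y
        simp only [map_add, LinearMap.add_apply, LinearMap.zero_apply] at b₁ b₂
        have := hB₁ x y
        have := hB₂ x y
        linarith
    have a₄ := a₃ u
    simp only [Prod.smul_mk, Prod.mk_add_mk, map_add, map_neg, map_smul, LinearMap.add_apply,
      LinearMap.neg_apply, LinearMap.smul_apply, smul_eq_mul, smul_neg]
    rw [hB₁ u x, hB₂ u y, eq_neg_of_add_eq_zero_right a₄]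
    nlinarith [mul_nonneg (mul_self_nonneg c) (sub_nonneg.2 hu.le)]
  have hb := finrank_add_sigPos_add_sigNeg_le B₁ B₂ _ hUF
  have hlt : LinearMap.ker f < U := by
    refine lt_of_le_of_ne le_sup_left fun he => ?_
    rw [← he] at hdU
    have := LinearMap.congr_fun ((hf _ _).symm.trans hdU) u
    simp only [map_neg, LinearMap.add_apply, LinearMap.neg_apply, LinearMap.zero_apply] at this
    linarith
  have := Submodule.finrank_lt_finrank_of_lt hlt
  omega

theorem sigPos_toQuadraticMap_mono (B₁ B₂ : LinearMap.BilinForm ℝ E)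
    (hle : ∀ x, B₁ x x ≤ B₂ x x) :
    sigPos B₁.toQuadraticMap ≤ sigPos B₂.toQuadraticMap := by
  obtain ⟨W, h, hW⟩ := exists_finrank_eq_sigPos_and_posDef B₁.toQuadraticMap
  rw [← h]
  exact le_sigPos_of_posDef _ fun x hx => (hW x hx).trans_le (hle x)

theorem sigNeg_toQuadraticMap_anti (B₁ B₂ : LinearMap.BilinForm ℝ E)
    (hle : ∀ x, B₁ x x ≤ B₂ x x) :
    sigNeg B₂.toQuadraticMap ≤ sigNeg B₁.toQuadraticMap := by
  rw [← sigPos_neg, ← sigPos_neg, ← toQuadraticMap_neg, ← toQuadraticMap_neg]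
  exact sigPos_toQuadraticMap_mono _ _ fun x => neg_le_neg (hle x)

end Signature

/-! ### Common Lagrangian complements. -/

section Lagrangian

variable {V : Type*} [AddCommGroup V] [Module ℝ V] [FiniteDimensional ℝ V]
  {σ : LinearMap.BilinForm ℝ V}

open Module

/-- An isotropic subspace of less than half dimension that meets finitely many Lagrangian planes
trivially can be enlarged. -/
theorem exists_isotropic_disjoint (hσ : IsSymplectic σ) {ι : Type*} [Finite ι] [Nonempty ι]
    (N : ι → LagrangianGrassmannian σ) (k : ℕ) (hk : 2 * k ≤ finrank ℝ V) :
    ∃ W : Submodule ℝ V, finrank ℝ W = k ∧ (∀ x ∈ W, ∀ y ∈ W, σ x y = 0) ∧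
      ∀ i, Disjoint (N i).toSubmodule W := by
  induction k with
  | zero => exact ⟨⊥, by simp, by simp, fun i => disjoint_bot_right⟩
  | succ k ih =>
    obtain ⟨W, hW, hiso, hdis⟩ := ih (by omega)
    have ho := LinearMap.BilinForm.finrank_orthogonal hσ.nondegenerate W
    -- Inside W^⊥ these are the vectors whose adjunction to W would fail. Each `p i` is proper: its
    -- dimension is at most k + (n - k) = n with dim V = 2n, whereas dim W^⊥ = 2n - k > n. Finitely
    -- many proper subspaces do not cover W^⊥.
    let p : ι → Submodule ℝ (σ.orthogonal W) := fun i =>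
      (W ⊔ (N i).toSubmodule ⊓ σ.orthogonal W).submoduleOf (σ.orthogonal W)
    have hWo : W ≤ σ.orthogonal W := fun x hx y hy => hiso y hy x hx
    have hp : ∀ i, p i ≠ ⊤ := by
      intro i h
      have h1 : σ.orthogonal W ≤ W ⊔ (N i).toSubmodule ⊓ σ.orthogonal W := by
        intro x hx
        have : (⟨x, hx⟩ : σ.orthogonal W) ∈ p i := h ▸ Submodule.mem_top
        exact this
      have h2 := Submodule.finrank_mono h1
      have h3 := Submodule.finrank_add_le_finrank_add_finrank W
        ((N i).toSubmodule ⊓ σ.orthogonal W)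
      have h4 : (N i).toSubmodule ⊓ σ.orthogonal W ≤
          σ.orthogonal ((N i).toSubmodule ⊔ W) := by
        rintro x ⟨hx, hx'⟩ y hy
        obtain ⟨a, ha, b, hb, rfl⟩ := Submodule.mem_sup.1 hy
        have e₁ := (N i).isotropic a ha x hx
        have e₂ : σ b x = 0 := hx' b hb
        change σ (a + b) x = 0
        rw [map_add, LinearMap.add_apply, e₁, e₂, add_zero]
      have h5 := Submodule.finrank_mono h4
      rw [LinearMap.BilinForm.finrank_orthogonal hσ.nondegenerate] at h5
      have h6 := Submodule.finrank_sup_add_finrank_inf_eq (N i).toSubmodule W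
      rw [(hdis i).eq_bot, finrank_bot] at h6
      have h7 := (N i).two_mul_finrank
      omega
    obtain ⟨⟨v, hv⟩, hvp⟩ := Submodule.exists_forall_notMem_of_forall_ne_top p hp
    have hvp' : ∀ i, v ∉ W ⊔ (N i).toSubmodule ⊓ σ.orthogonal W := hvp
    have hvW : v ∉ W := fun h => hvp' (Classical.arbitrary ι) (Submodule.mem_sup_left h)
    have hWv : ∀ x ∈ W, σ x v = 0 := hv
    have hvW' : ∀ x ∈ W, σ v x = 0 := fun x hx => hσ.alt.isRefl _ _ (hWv x hx)
    refine ⟨W ⊔ Submodule.span ℝ {v}, by rw [Submodule.finrank_sup_span_singleton hvW, hW],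
      ?_, ?_⟩
    · intro x hx y hy
      obtain ⟨a, ha, _, hz, rfl⟩ := Submodule.mem_sup.1 hx
      obtain ⟨c, rfl⟩ := Submodule.mem_span_singleton.1 hz
      obtain ⟨b, hb, _, hz, rfl⟩ := Submodule.mem_sup.1 hy
      obtain ⟨d, rfl⟩ := Submodule.mem_span_singleton.1 hz
      simp [hiso a ha b hb, hWv a ha, hvW' b hb, hσ.alt.self_eq_zero v]
    · intro i
      rw [Submodule.disjoint_def]
      intro x hxN hx
      obtain ⟨a, ha, _, hz, rfl⟩ := Submodule.mem_sup.1 hx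
      obtain ⟨c, rfl⟩ := Submodule.mem_span_singleton.1 hz
      by_cases hc : c = 0
      · subst hc
        rw [zero_smul, add_zero] at hxN ⊢
        exact Submodule.disjoint_def.1 (hdis i) a hxN ha
      · refine absurd ?_ (hvp' i)
        have : v = c⁻¹ • (-a + (a + c • v)) := by
          rw [neg_add_cancel_left, smul_smul, inv_mul_cancel₀ hc, one_smul]
        rw [this]
        refine Submodule.smul_mem _ _ (add_mem (Submodule.mem_sup_left (neg_mem ha))
          (Submodule.mem_sup_right ⟨hxN, ?_⟩))
        exact add_mem (hWo ha) (Submodule.smul_mem _ _ hv)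

/-- Finitely many Lagrangian planes have a common Lagrangian complement. -/
theorem exists_common_isCompl (hσ : IsSymplectic σ) {ι : Type*} [Finite ι] [Nonempty ι]
    (N : ι → LagrangianGrassmannian σ) :
    ∃ P : LagrangianGrassmannian σ, ∀ i, IsCompl (N i).toSubmodule P.toSubmodule := by
  have h := (N (Classical.arbitrary ι)).two_mul_finrank
  obtain ⟨W, hW, hiso, hdis⟩ := exists_isotropic_disjoint hσ N _ h.le
  refine ⟨⟨W, hiso, hW ▸ h⟩, fun i => ?_⟩
  have h' := (N i).two_mul_finrank
  exact (Submodule.isCompl_iff_disjoint _ _ (by change _ ≤ finrank ℝ _ + finrank ℝ W; omega)).2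
    (hdis i)

end Lagrangian

/-! ### Size and vanishing of the index. -/

section IndexBounds

variable {V : Type*} [AddCommGroup V] [Module ℝ V] [FiniteDimensional ℝ V]
  {σ : LinearMap.BilinForm ℝ V}

open Module

omit [FiniteDimensional ℝ V] in
theorem maslovIndex_nonneg (P L₁ L₂ : LagrangianGrassmannian σ) : 0 ≤ maslovIndex P L₁ L₂ := by
  unfold maslovIndex
  positivity

/-- A crude bound suffices: it only serves as a uniform constant for one signature jump or one
change of chart. -/
theorem maslovIndex_le (P L₁ L₂ : LagrangianGrassmannian σ) :
    maslovIndex P L₁ L₂ ≤ 2 * finrank ℝ V := by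
  have h₁ := sigPos_le_finrank (maslovForm P L₁ L₂)
  have h₂ := Submodule.finrank_le (maslovForm P L₁ L₂).radical
  have h₃ : finrank ℝ (MaslovSpace P L₁ L₂) ≤ finrank ℝ (sumInf P L₁ L₂) :=
    (tripleInf P L₁ L₂).finrank_quotient_le
  have h₄ := Submodule.finrank_le (sumInf P L₁ L₂)
  have h₅ : (sigPos (maslovForm P L₁ L₂) : ℝ) ≤ finrank ℝ V := by exact_mod_cast (by omega)
  have h₆ : (finrank ℝ (maslovForm P L₁ L₂).radical : ℝ) ≤ finrank ℝ V := by
    exact_mod_cast (by omega)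
  have h₇ : (0 : ℝ) ≤ finrank ℝ V := by positivity
  unfold maslovIndex
  linarith

omit [FiniteDimensional ℝ V] in
theorem half_le_maslovIndex (P L₁ L₂ : LagrangianGrassmannian σ) (h : maslovIndex P L₁ L₂ ≠ 0) :
    1 / 2 ≤ maslovIndex P L₁ L₂ := by
  unfold maslovIndex at h ⊢
  rcases Nat.eq_zero_or_pos (sigPos (maslovForm P L₁ L₂)) with h₁ | h₁
  · rcases Nat.eq_zero_or_pos (finrank ℝ (maslovForm P L₁ L₂).radical) with h₂ | h₂
    · simp [h₁, h₂] at h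
    · have : (1 : ℝ) ≤ finrank ℝ (maslovForm P L₁ L₂).radical := by exact_mod_cast h₂
      have : (0 : ℝ) ≤ sigPos (maslovForm P L₁ L₂) := by positivity
      linarith
  · have : (1 : ℝ) ≤ sigPos (maslovForm P L₁ L₂) := by exact_mod_cast h₁
    have : (0 : ℝ) ≤ finrank ℝ (maslovForm P L₁ L₂).radical := by positivity
    linarith

/-- A real quadratic form without positive subspaces and without radical is negative definite. -/
theorem sigPos_eq_zero_and_radical_eq_bot_iff {E : Type*} [AddCommGroup E] [Module ℝ E]
    [FiniteDimensional ℝ E] (Q : QuadraticForm ℝ E) :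
    (sigPos Q = 0 ∧ Q.radical = ⊥) ↔ ∀ x, x ≠ 0 → Q x < 0 := by
  constructor
  · rintro ⟨hs, hr⟩
    have h := QuadraticForm.sigPos_add_sigNeg_add_radical (Q := Q)
    rw [hs, hr, finrank_bot] at h
    obtain ⟨W, hW, hneg⟩ := exists_finrank_eq_sigNeg_and_negDef Q
    have hW' : W = ⊤ := Submodule.eq_top_of_finrank_eq (by omega)
    intro x hx
    have := hneg ⟨x, hW' ▸ Submodule.mem_top⟩ (by simpa using hx)
    simpa using this
  · intro h
    constructor
    · have := QuadraticForm.sigPos_add_finrank_le_of_nonpos (Q := Q) (V := ⊤) (fun x _ => by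
        by_cases hx : x = 0
        · simp [hx]
        · exact (h x hx).le)
      rw [finrank_top] at this
      omega
    · rw [Submodule.eq_bot_iff]
      intro x hx
      by_contra hx0
      exact (h x hx0).ne hx.1

/-- Zero index means that q is negative definite on the quotient; the second alternative says that
the class of x₁ + x₂ is zero. -/
theorem maslovIndex_eq_zero_iff (P L₁ L₂ : LagrangianGrassmannian σ) :
    maslovIndex P L₁ L₂ = 0 ↔
      ∀ x₁ ∈ L₁.toSubmodule, ∀ x₂ ∈ L₂.toSubmodule, x₁ + x₂ ∈ P.toSubmodule →
        σ x₁ x₂ < 0 ∨ (x₁ + x₂ ∈ L₁.toSubmodule ∧ x₁ + x₂ ∈ L₂.toSubmodule) := by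
  have h₁ : maslovIndex P L₁ L₂ = 0 ↔
      sigPos (maslovForm P L₁ L₂) = 0 ∧ (maslovForm P L₁ L₂).radical = ⊥ := by
    unfold maslovIndex
    rw [add_eq_zero_iff_of_nonneg (by positivity) (by positivity),
      ← Submodule.finrank_eq_zero (R := ℝ)]
    simp
  have h₂ : ∀ (x₁ x₂ : V) (hx₁ : x₁ ∈ L₁.toSubmodule) (hx₂ : x₂ ∈ L₂.toSubmodule)
      (hx : x₁ + x₂ ∈ P.toSubmodule), maslovClass P L₁ L₂ x₁ x₂ hx₁ hx₂ hx = 0 ↔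
        (x₁ + x₂ ∈ L₁.toSubmodule ∧ x₁ + x₂ ∈ L₂.toSubmodule) := by
    intro x₁ x₂ hx₁ hx₂ hx
    unfold maslovClass
    rw [Submodule.mkQ_apply, Submodule.Quotient.mk_eq_zero]
    constructor
    · intro h
      have h' : x₁ + x₂ ∈ L₁.toSubmodule ⊓ P.toSubmodule ⊓ L₂.toSubmodule := h
      exact ⟨h'.1.1, h'.2⟩
    · intro h
      exact (⟨⟨h.1, hx⟩, h.2⟩ : x₁ + x₂ ∈ L₁.toSubmodule ⊓ P.toSubmodule ⊓ L₂.toSubmodule)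
  rw [h₁, sigPos_eq_zero_and_radical_eq_bot_iff]
  constructor
  · intro h x₁ hx₁ x₂ hx₂ hx
    by_cases h0 : maslovClass P L₁ L₂ x₁ x₂ hx₁ hx₂ hx = 0
    · exact Or.inr ((h₂ _ _ hx₁ hx₂ hx).1 h0)
    · left
      rw [← maslovForm_apply P L₁ L₂ x₁ x₂ hx₁ hx₂ hx]
      exact h _ h0
  · intro h x hx0
    obtain ⟨⟨w, hw, hwP⟩, rfl⟩ := (tripleInf P L₁ L₂).mkQ_surjective x
    obtain ⟨x₁, hx₁, x₂, hx₂, rfl⟩ := Submodule.mem_sup.1 hw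
    change maslovForm P L₁ L₂ (maslovClass P L₁ L₂ x₁ x₂ hx₁ hx₂ hwP) < 0
    rw [maslovForm_apply]
    rcases h x₁ hx₁ x₂ hx₂ hwP with h' | h'
    · exact h'
    · exact absurd ((h₂ _ _ hx₁ hx₂ hwP).2 h') hx0

end IndexBounds

/-! ### Differentiability of transition maps. -/

section Transition

variable {E F G H W : Type*} [NormedAddCommGroup E] [NormedSpace ℝ E] [NormedAddCommGroup F]
  [NormedSpace ℝ F] [NormedAddCommGroup G] [NormedSpace ℝ G] [NormedAddCommGroup H]
  [NormedSpace ℝ H] [NormedAddCommGroup W] [NormedSpace ℝ W] [CompleteSpace E]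

/-- The transition map `R ↦ p' (c + j R) (p (c + j R))⁻¹` between affine charts preserves
differentiability. -/
theorem differentiableWithinAt_transition {R : ℝ → E →L[ℝ] F} {I : Set ℝ} {t : ℝ}
    (hR : DifferentiableWithinAt ℝ R I t) (c : E →L[ℝ] W) (j : F →L[ℝ] W) (p : W →L[ℝ] G)
    (p' : W →L[ℝ] H) (e : E ≃L[ℝ] G) (he : (e : E →L[ℝ] G) = p ∘L (c + j ∘L R t)) :
    DifferentiableWithinAt ℝ
        (fun s => (p' ∘L (c + j ∘L R s)) ∘L (p ∘L (c + j ∘L R s)).inverse) I t ∧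
      ∀ᶠ s in 𝓝[I] t, p ∘L (c + j ∘L R s) ∈ range ((↑) : (E ≃L[ℝ] G) → E →L[ℝ] G) := by
  have hR' : DifferentiableWithinAt ℝ (fun s => c + j ∘L R s) I t :=
    ((differentiableWithinAt_const _).clm_comp hR).const_add c
  have hA : DifferentiableWithinAt ℝ (fun s => p ∘L (c + j ∘L R s)) I t :=
    (differentiableWithinAt_const _).clm_comp hR'
  have hinv : DifferentiableAt ℝ ContinuousLinearMap.inverse (p ∘L (c + j ∘L R t)) := by
    rw [← he]
    exact (contDiffAt_map_inverse (n := 1) e).differentiableAt one_ne_zero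
  have hAinv : DifferentiableWithinAt ℝ (fun s => (p ∘L (c + j ∘L R s)).inverse) I t :=
    DifferentiableAt.comp_differentiableWithinAt (f := fun s => p ∘L (c + j ∘L R s)) t hinv hA
  refine ⟨((differentiableWithinAt_const _).clm_comp hR').clm_comp hAinv,
    hA.continuousWithinAt.eventually ?_⟩
  beta_reduce
  rw [← he]
  exact ContinuousLinearEquiv.nhds e

end Transition

/-! ### Affine charts and their symmetric forms. -/

section Charts

variable {V : Type*} [NormedAddCommGroup V] [NormedSpace ℝ V] [FiniteDimensional ℝ V]
  {σ : LinearMap.BilinForm ℝ V}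

open Module

/-- The bilinear form `(x, y) ↦ σ(x, S y)` on `M` attached to a chart coordinate `S : M → P`. -/
noncomputable def chartForm (σ : LinearMap.BilinForm ℝ V) {M P : Submodule ℝ V} (S : M →L[ℝ] P) :
    LinearMap.BilinForm ℝ M :=
  σ.compl₁₂ M.subtype (P.subtype ∘ₗ (S : M →ₗ[ℝ] P))

omit [FiniteDimensional ℝ V] in
@[simp]
theorem chartForm_apply {M P : Submodule ℝ V} (S : M →L[ℝ] P) (x y : M) :
    chartForm σ S x y = σ x (S y) := rfl

omit [FiniteDimensional ℝ V] in
theorem mem_graphOver {M P : Submodule ℝ V} {S : M →L[ℝ] P} {v : V} :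
    v ∈ graphOver S ↔ ∃ x : M, (x : V) + (S x : V) = v := Iff.rfl

omit [FiniteDimensional ℝ V] in
theorem add_mem_graphOver {M P : Submodule ℝ V} (S : M →L[ℝ] P) (x : M) :
    (x : V) + (S x : V) ∈ graphOver S := ⟨x, rfl⟩

omit [FiniteDimensional ℝ V] in
theorem mem_graphOver_iff_of_mem {M P : Submodule ℝ V} (h : IsCompl M P) (S : M →L[ℝ] P)
    (x : M) : (x : V) ∈ graphOver S ↔ S x = 0 := by
  constructor
  · rintro ⟨y, hy⟩
    have hy' : (y : V) + (S y : V) = x := hy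
    have h1 : (S y : V) = ((x - y : M) : V) := by
      rw [Submodule.coe_sub, ← hy', add_sub_cancel_left]
    have h2 : (S y : V) = 0 := Submodule.disjoint_def.1 h.disjoint _ (h1 ▸ (x - y).2) (S y).2
    have h3 : y = x := by
      rw [h2, add_zero] at hy'
      exact Subtype.ext hy'
    rw [← h3]
    exact Subtype.ext h2
  · intro hx
    have := add_mem_graphOver S x
    rwa [hx, Submodule.coe_zero, add_zero] at this

variable {M P L₁ L₂ : LagrangianGrassmannian σ}

omit [FiniteDimensional ℝ V] in
-- Since M and P are isotropic, isotropy of the graph leaves exactly the symmetry of the form.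
theorem chartForm_symm (hσ : IsSymplectic σ)
    {S : M.toSubmodule →L[ℝ] P.toSubmodule} (hS : L₁.toSubmodule = graphOver S)
    (x y : M.toSubmodule) : chartForm σ S x y = chartForm σ S y x := by
  have h := L₁.isotropic _ (hS ▸ add_mem_graphOver S x) _ (hS ▸ add_mem_graphOver S y)
  have h₁ := M.isotropic _ x.2 _ y.2
  have h₂ := P.isotropic _ (S x).2 _ (S y).2
  have h₃ := LinearMap.BilinForm.IsAlt.neg_eq hσ.alt (S x : V) (y : V)
  simp only [map_add, LinearMap.add_apply] at h
  simp only [chartForm_apply]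
  linarith

omit [FiniteDimensional ℝ V] in
theorem eq_zero_of_forall_of_isCompl (hσ : IsSymplectic σ)
    (h : IsCompl M.toSubmodule P.toSubmodule) (z : P.toSubmodule)
    (hz : ∀ m : M.toSubmodule, σ m z = 0) : z = 0 := by
  refine Subtype.ext (hσ.nondegenerate.2 z fun v => ?_)
  obtain ⟨a, ha, b, hb, rfl⟩ := Submodule.mem_sup.1 (h.sup_eq_top ▸ Submodule.mem_top : v ∈ _)
  rw [map_add, LinearMap.add_apply, hz ⟨a, ha⟩, P.isotropic b hb z z.2, add_zero]

/-- In a chart over the reference plane, the index vanishes exactly when the coordinate forms are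
negatively coupled. -/
theorem maslovIndex_eq_zero_iff_isNegativeCoupling (hσ : IsSymplectic σ)
    (h : IsCompl M.toSubmodule P.toSubmodule)
    {S₁ S₂ : M.toSubmodule →L[ℝ] P.toSubmodule} (hS₁ : L₁.toSubmodule = graphOver S₁)
    (hS₂ : L₂.toSubmodule = graphOver S₂) :
    maslovIndex M L₁ L₂ = 0 ↔ IsNegativeCoupling (chartForm σ S₁) (chartForm σ S₂) := by
  have hker : ∀ x y, chartForm σ S₁ x + chartForm σ S₂ y = 0 ↔ S₁ x + S₂ y = 0 := by
    intro x y
    have e : ∀ m : M.toSubmodule, (chartForm σ S₁ x + chartForm σ S₂ y) m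
        = σ m ((S₁ x + S₂ y : P.toSubmodule) : V) := by
      intro m
      rw [LinearMap.add_apply, chartForm_symm hσ hS₁, chartForm_symm hσ hS₂, Submodule.coe_add,
        map_add]
      rfl
    constructor
    · intro h0
      refine eq_zero_of_forall_of_isCompl hσ h _ fun m => ?_
      rw [← e, h0]
      rfl
    · intro h0
      refine LinearMap.ext fun m => ?_
      rw [e, h0]
      simp
  have hker₁ : ∀ x, chartForm σ S₁ x = 0 ↔ S₁ x = 0 := fun x => by simpa using hker x 0
  have hker₂ : ∀ x, chartForm σ S₂ x = 0 ↔ S₂ x = 0 := fun x => by simpa using hker 0 x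
  -- The terms within M and within P vanish by isotropy; substituting S₂ y = -S₁ x in the two mixed
  -- terms turns q into B₂(y, y) - B₁(x, x).
  have hval : ∀ x y : M.toSubmodule, S₁ x + S₂ y = 0 →
      σ (x + S₁ x : V) (y + S₂ y : V) = chartForm σ S₂ y y - chartForm σ S₁ x x := by
    intro x y hxy
    have e₁ : (S₂ y : V) = -(S₁ x : V) := by
      rw [eq_neg_of_add_eq_zero_right hxy]; rfl
    have e₂ := M.isotropic _ x.2 _ y.2
    have e₃ := P.isotropic _ (S₁ x).2 _ (S₂ y).2
    have e₄ := LinearMap.BilinForm.IsAlt.neg_eq hσ.alt (S₁ x : V) (y : V)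
    simp only [chartForm_apply, map_add, LinearMap.add_apply]
    rw [e₃, e₂, e₁, map_neg, map_neg]
    linarith
  have hsum : ∀ x y : M.toSubmodule, S₁ x + S₂ y = 0 →
      (x + S₁ x : V) + (y + S₂ y) = ((x + y : M.toSubmodule) : V) := by
    intro x y hxy
    have e₁ : (S₁ x : V) + (S₂ y : V) = 0 := by
      rw [← Submodule.coe_add, hxy]; rfl
    calc (x + S₁ x : V) + (y + S₂ y) = x + y + ((S₁ x : V) + (S₂ y : V)) := by abel
      _ = _ := by rw [e₁, add_zero]; rfl
  rw [maslovIndex_eq_zero_iff, hS₁, hS₂]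
  constructor
  · intro H x y hxy
    rw [hker] at hxy
    have := H _ (add_mem_graphOver S₁ x) _ (add_mem_graphOver S₂ y)
      (by rw [hsum x y hxy]; exact (x + y).2)
    rw [hval x y hxy, hsum x y hxy, mem_graphOver_iff_of_mem h, mem_graphOver_iff_of_mem h] at this
    rwa [hker₁, hker₂]
  · rintro H _ ⟨x, rfl⟩ _ ⟨y, rfl⟩ hM
    change (x + S₁ x : V) + (y + S₂ y) ∈ M.toSubmodule at hM
    change σ (x + S₁ x : V) (y + S₂ y : V) < 0 ∨ (x + S₁ x : V) + (y + S₂ y) ∈ graphOver S₁ ∧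
      (x + S₁ x : V) + (y + S₂ y) ∈ graphOver S₂
    have hxy : S₁ x + S₂ y = 0 := by
      have e : (x + S₁ x : V) + (y + S₂ y) - (x + y : M.toSubmodule) =
          ((S₁ x + S₂ y : P.toSubmodule) : V) := by
        rw [Submodule.coe_add, Submodule.coe_add]
        abel
      refine Subtype.ext (Submodule.disjoint_def.1 h.disjoint _ ?_ (S₁ x + S₂ y).2)
      rw [← e]
      exact sub_mem hM (x + y).2
    rw [hval x y hxy, hsum x y hxy, mem_graphOver_iff_of_mem h, mem_graphOver_iff_of_mem h,
      ← hker₁, ← hker₂]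
    exact H x y ((hker x y).2 hxy)

/-- Change of chart: a curve that is differentiable at `t` is differentiable in every affine chart
that contains `Λ(t)`. -/
theorem CurveDifferentiableWithinAt.exists_chart {L : ℝ → LagrangianGrassmannian σ} {I : Set ℝ}
    {t : ℝ} (hL : CurveDifferentiableWithinAt L I t) (ht : t ∈ I)
    (h : IsCompl M.toSubmodule P.toSubmodule) (hLt : IsCompl (L t).toSubmodule P.toSubmodule) :
    ∃ S : ℝ → (M.toSubmodule →L[ℝ] P.toSubmodule),
      DifferentiableWithinAt ℝ S I t ∧ ∀ᶠ s in 𝓝[I] t, (L s).toSubmodule = graphOver (S s) := by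
  obtain ⟨E, Q, hEQ, R, hR, hgr⟩ := hL
  have hgt : (L t).toSubmodule = graphOver (R t) := hgr.self_of_nhdsWithin ht
  let p : V →L[ℝ] M.toSubmodule :=
    LinearMap.toContinuousLinearMap (Submodule.projectionOnto _ _ h)
  have hp0 : ∀ v, p v = 0 → v ∈ P.toSubmodule := fun v hv =>
    (Submodule.projectionOnto_apply_eq_zero_iff h).1 hv
  have hpM : ∀ x : M.toSubmodule, p x = x := fun x => Submodule.projectionOnto_apply_left h x
  let p' : V →L[ℝ] P.toSubmodule :=
    (ContinuousLinearMap.id ℝ V - M.toSubmodule.subtypeL ∘L p).codRestrict P.toSubmodule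
      (fun v => hp0 _ (by simp [hpM]))
  have hpp' : ∀ v, (p v : V) + (p' v : V) = v := fun v => by simp [p']
  let G : ℝ → E.toSubmodule →L[ℝ] V := fun s =>
    E.toSubmodule.subtypeL + Q.toSubmodule.subtypeL ∘L R s
  have hGmem : ∀ s x, G s x ∈ graphOver (R s) := fun s x => add_mem_graphOver (R s) x
  let A : ℝ → E.toSubmodule →L[ℝ] M.toSubmodule := fun s => p ∘L G s
  -- Transversality of Λ(t) and P makes the projection of Λ(t) to M along P injective; dimensions
  -- make it an isomorphism, which persists for s near t.
  have hinj : Function.Injective (A t : E.toSubmodule →ₗ[ℝ] M.toSubmodule) := by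
    rw [← LinearMap.ker_eq_bot, LinearMap.ker_eq_bot']
    intro x hx
    have h0 : (x : V) + (R t x : V) = 0 :=
      Submodule.disjoint_def.1 hLt.disjoint _ (hgt ▸ hGmem t x) (hp0 _ hx)
    refine Subtype.ext (Submodule.disjoint_def.1 hEQ.disjoint _ x.2 ?_)
    rw [eq_neg_of_add_eq_zero_left h0]
    exact neg_mem (R t x).2
  have hdim : finrank ℝ E.toSubmodule = finrank ℝ M.toSubmodule := by
    have := E.two_mul_finrank
    have := M.two_mul_finrank
    omega
  let e : E.toSubmodule ≃L[ℝ] M.toSubmodule :=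
    (LinearEquiv.ofInjectiveOfFinrankEq _ hinj hdim).toContinuousLinearEquiv
  have he : (e : E.toSubmodule →L[ℝ] M.toSubmodule) = A t := by
    ext x; rfl
  obtain ⟨hdiff, hev⟩ := differentiableWithinAt_transition hR E.toSubmodule.subtypeL
    Q.toSubmodule.subtypeL p p' e he
  refine ⟨fun s => (p' ∘L G s) ∘L (A s).inverse, hdiff, ?_⟩
  · filter_upwards [hev, hgr] with s ⟨a, ha⟩ hs
    rw [hs]
    replace ha : (a : E.toSubmodule →L[ℝ] M.toSubmodule) = A s := ha
    have ha' : ∀ x, a x = p (G s x) := fun x => by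
      rw [← ContinuousLinearEquiv.coe_coe, ha]; rfl
    have hval : ∀ x, ((a x : M.toSubmodule) : V) +
        ((((p' ∘L G s) ∘L (A s).inverse) (a x) : P.toSubmodule) : V) = G s x := by
      intro x
      rw [← ha, ContinuousLinearMap.inverse_equiv]
      simp only [ContinuousLinearMap.comp_apply, ContinuousLinearEquiv.coe_coe,
        ContinuousLinearEquiv.symm_apply_apply]
      rw [ha', hpp']
    ext v
    constructor
    · rintro ⟨x, rfl⟩
      exact ⟨a x, hval x⟩
    · rintro ⟨m, rfl⟩
      refine ⟨a.symm m, ?_⟩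
      have := hval (a.symm m)
      rw [ContinuousLinearEquiv.apply_symm_apply] at this
      exact this.symm

omit [FiniteDimensional ℝ V] in
/-- The velocity form, read in a chart. -/
theorem IsVelocityForm.apply_chart {L : ℝ → LagrangianGrassmannian σ} {I : Set ℝ} {t : ℝ}
    {q : QuadraticForm ℝ (L t).toSubmodule} (hq : IsVelocityForm L I t q) (ht : t ∈ I)
    {S : ℝ → (M.toSubmodule →L[ℝ] P.toSubmodule)} {S' : M.toSubmodule →L[ℝ] P.toSubmodule}
    (hS : HasDerivWithinAt S S' I t)
    (hgr : ∀ᶠ s in 𝓝[I] t, (L s).toSubmodule = graphOver (S s)) (a : M.toSubmodule)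
    (x : (L t).toSubmodule) (hx : (x : V) = a + S t a) :
    q x = chartForm σ S' a a := by
  classical
  have hgt : (L t).toSubmodule = graphOver (S t) := hgr.self_of_nhdsWithin ht
  -- The test curve must lie in Λ(s) for every s in I, also outside the chart; the default 0 belongs
  -- to every plane.
  let ℓ : ℝ → V := fun s =>
    if (L s).toSubmodule = graphOver (S s) then (a : V) + (S s a : V) else 0
  have hℓ : ∀ s ∈ I, ℓ s ∈ (L s).toSubmodule := by
    intro s _
    by_cases hs : (L s).toSubmodule = graphOver (S s)
    · simp only [ℓ, if_pos hs]
      rw [hs]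
      exact add_mem_graphOver (S s) a
    · simp [ℓ, hs]
  have h2 : HasDerivWithinAt (fun s => S s a) (S' a) I t := by
    simpa using hS.clm_apply (hasDerivWithinAt_const t I a)
  have h3 : HasDerivWithinAt (fun s => (a : V) + (S s a : V)) ((S' a : P.toSubmodule) : V) I t :=
    (P.toSubmodule.subtypeL.hasFDerivAt.comp_hasDerivWithinAt t h2).const_add (a : V)
  have h4 : HasDerivWithinAt ℓ ((S' a : P.toSubmodule) : V) I t := by
    refine h3.congr_of_eventuallyEq ?_ (if_pos hgt)
    filter_upwards [hgr] with s hs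
    exact if_pos hs
  rw [hq ℓ _ hℓ h4 x ((if_pos hgt).trans hx.symm), hx, map_add, LinearMap.add_apply,
    P.isotropic _ (S t a).2 _ (S' a).2, add_zero]
  rfl

theorem hasDerivWithinAt_chartForm {I : Set ℝ} {t : ℝ}
    {S : ℝ → (M.toSubmodule →L[ℝ] P.toSubmodule)} {S' : M.toSubmodule →L[ℝ] P.toSubmodule}
    (hS : HasDerivWithinAt S S' I t) (a : M.toSubmodule) :
    HasDerivWithinAt (fun s => chartForm σ (S s) a a)
      (chartForm σ S' a a) I t := by
  have h2 : HasDerivWithinAt (fun s => S s a) (S' a) I t := by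
    simpa using hS.clm_apply (hasDerivWithinAt_const t I a)
  exact (LinearMap.toContinuousLinearMap
    (σ (a : V) ∘ₗ P.toSubmodule.subtype)).hasFDerivAt.comp_hasDerivWithinAt t h2

end Charts

/-! ### Monotone curves have finite index. -/

section Increasing

variable {V : Type*} [NormedAddCommGroup V] [NormedSpace ℝ V] [FiniteDimensional ℝ V]
  {σ : LinearMap.BilinForm ℝ V}

open Module

omit [FiniteDimensional ℝ V] in
theorem graphOver_injective {M P : Submodule ℝ V} (h : IsCompl M P) :
    Function.Injective (graphOver : (M →L[ℝ] P) → Submodule ℝ V) := by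
  intro S₁ S₂ hS
  ext x
  obtain ⟨y, hy⟩ := mem_graphOver.1 (hS ▸ add_mem_graphOver S₁ x : (x : V) + (S₁ x : V) ∈ _)
  have e : ((y - x : M) : V) = ((S₁ x - S₂ y : P) : V) := by
    rw [Submodule.coe_sub, Submodule.coe_sub, sub_eq_sub_iff_add_eq_add, hy]
    abel
  have e₀ : ((y - x : M) : V) = 0 :=
    Submodule.disjoint_def.1 h.disjoint _ (y - x).2 (e ▸ (S₁ x - S₂ y).2)
  have hyx : y = x := sub_eq_zero.1 (Subtype.ext e₀)
  rw [hyx] at hy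
  exact (add_left_cancel hy).symm

omit [FiniteDimensional ℝ V] in
theorem isCompl_graphOver {M P : Submodule ℝ V} (h : IsCompl M P) (S : M →L[ℝ] P) :
    IsCompl (graphOver S) P := by
  constructor
  · rw [Submodule.disjoint_def]
    rintro _ ⟨x, rfl⟩ hx
    change (x : V) + (S x : V) ∈ P at hx
    have hx0 : x = 0 :=
      Subtype.ext (Submodule.disjoint_def.1 h.disjoint _ x.2 ((P.add_mem_iff_left (S x).2).1 hx))
    rw [hx0, map_zero]
  · rw [codisjoint_iff, eq_top_iff]
    intro v _
    obtain ⟨a, ha, b, hb, rfl⟩ := Submodule.mem_sup.1 (h.sup_eq_top ▸ Submodule.mem_top : v ∈ M ⊔ P)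
    refine Submodule.mem_sup.2 ⟨_, add_mem_graphOver S ⟨a, ha⟩, b - S ⟨a, ha⟩,
      sub_mem hb (S ⟨a, ha⟩).2, ?_⟩
    simp only
    abel

variable {M P : LagrangianGrassmannian σ}

/-- A differentiable curve has a coordinate in the chart `(M, P)`, differentiable wherever the
curve is transversal to `P`. -/
theorem CurveDifferentiableOn.exists_chart {L : ℝ → LagrangianGrassmannian σ} {I : Set ℝ}
    (hL : CurveDifferentiableOn L I) (h : IsCompl M.toSubmodule P.toSubmodule) :
    ∃ S : ℝ → (M.toSubmodule →L[ℝ] P.toSubmodule),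
      ∀ t ∈ I, IsCompl (L t).toSubmodule P.toSubmodule →
        DifferentiableWithinAt ℝ S I t ∧ ∀ᶠ s in 𝓝[I] t, (L s).toSubmodule = graphOver (S s) := by
  classical
  -- Coordinates are unique, so this pointwise choice agrees with every local differentiable
  -- coordinate; a single S serves all t.
  let S : ℝ → (M.toSubmodule →L[ℝ] P.toSubmodule) := fun s =>
    if hs : ∃ R : M.toSubmodule →L[ℝ] P.toSubmodule, (L s).toSubmodule = graphOver R
    then hs.choose else 0
  have hS : ∀ s (R : M.toSubmodule →L[ℝ] P.toSubmodule), (L s).toSubmodule = graphOver R →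
      S s = R := by
    intro s R hR
    have hs : ∃ R : M.toSubmodule →L[ℝ] P.toSubmodule, (L s).toSubmodule = graphOver R := ⟨R, hR⟩
    simp only [S, dif_pos hs]
    exact graphOver_injective h (hs.choose_spec.symm.trans hR)
  refine ⟨S, fun t ht hLt => ?_⟩
  obtain ⟨R, hR, hgr⟩ := (hL t ht).exists_chart ht h hLt
  refine ⟨hR.congr_of_eventuallyEq ?_ (hS t _ (hgr.self_of_nhdsWithin ht)), ?_⟩
  · filter_upwards [hgr] with s hs
    exact hS s _ hs
  · filter_upwards [hgr] with s hs
    rw [hS s _ hs, hs]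

/-- The index of all pairs of points of `[a, b]` is bounded by the increments of a function. -/
def IsIndexControlled (M : LagrangianGrassmannian σ) (L : ℝ → LagrangianGrassmannian σ)
    (a b : ℝ) : Prop :=
  ∃ g : ℝ → ℝ, ∀ s s', a ≤ s → s < s' → s' ≤ b → maslovIndex M (L s) (L s') ≤ g s' - g s

/-- The chart forms increase with time, so ind⁺ - ind⁻ is nondecreasing. Where both indices are
unchanged the Maslov index vanishes; otherwise the difference jumps by at least 1, and the factor 2
dim V pays for the index. -/
theorem isIndexControlled_of_isCompl (hσ : IsSymplectic σ) {L : ℝ → LagrangianGrassmannian σ}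
    {I : Set ℝ} (hL : CurveDifferentiableOn L I) (hmono : IsMonotoneIncreasingOn L I)
    (h : IsCompl M.toSubmodule P.toSubmodule) {a b : ℝ} (hab : Icc a b ⊆ I)
    (hP : ∀ s ∈ Icc a b, IsCompl (L s).toSubmodule P.toSubmodule) :
    IsIndexControlled M L a b := by
  obtain ⟨S, hS⟩ := hL.exists_chart h
  have hgr : ∀ s ∈ Icc a b, (L s).toSubmodule = graphOver (S s) := fun s hs =>
    (hS s (hab hs) (hP s hs)).2.self_of_nhdsWithin (hab hs)
  have hd : ∀ x : M.toSubmodule, ∀ s ∈ Icc a b, ∃ c, 0 ≤ c ∧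
      HasDerivWithinAt (fun s => chartForm σ (S s) x x) c I s := by
    intro x s hs
    obtain ⟨hdiff, hev⟩ := hS s (hab hs) (hP s hs)
    obtain ⟨S', hS'⟩ : ∃ S', HasDerivWithinAt S S' I s :=
      ⟨_, HasFDerivWithinAt.hasDerivWithinAt (DifferentiableWithinAt.hasFDerivWithinAt hdiff)⟩
    obtain ⟨q, hq, hq0⟩ := hmono s (hab hs)
    refine ⟨_, ?_, hasDerivWithinAt_chartForm hS' x⟩
    rw [← hq.apply_chart (hab hs) hS' hev x ⟨_, hgr s hs ▸ add_mem_graphOver (S s) x⟩ rfl]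
    exact hq0 _
  have hle : ∀ x : M.toSubmodule, MonotoneOn (fun s => chartForm σ (S s) x x) (Icc a b) := by
    intro x
    choose! c hc0 hc using hd x
    refine monotoneOn_of_hasDerivWithinAt_nonneg (convex_Icc a b) (f' := c)
      (fun s hs => ((hc s hs).continuousWithinAt).mono hab)
      (fun s hs => (hc s (interior_subset hs)).mono (interior_subset.trans hab))
      (fun s hs => hc0 s (interior_subset hs))
  refine ⟨fun s => 2 * finrank ℝ V * ((sigPos (chartForm σ (S s)).toQuadraticMap : ℝ) -
    sigNeg (chartForm σ (S s)).toQuadraticMap), fun s s' has hss' hsb => ?_⟩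
  have hs : s ∈ Icc a b := ⟨has, hss'.le.trans hsb⟩
  have hs' : s' ∈ Icc a b := ⟨has.trans hss'.le, hsb⟩
  have hle' : ∀ x, chartForm σ (S s) x x ≤ chartForm σ (S s') x x := fun x =>
    hle x hs hs' hss'.le
  have hp := sigPos_toQuadraticMap_mono _ _ hle'
  have hn := sigNeg_toQuadraticMap_anti _ _ hle'
  have hC : (0 : ℝ) ≤ 2 * finrank ℝ V := by positivity
  have hind := maslovIndex_le M (L s) (L s')
  rw [← mul_sub]
  by_cases heq : sigPos (chartForm σ (S s)).toQuadraticMap =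
        sigPos (chartForm σ (S s')).toQuadraticMap ∧
      sigNeg (chartForm σ (S s)).toQuadraticMap = sigNeg (chartForm σ (S s')).toQuadraticMap
  · rw [(maslovIndex_eq_zero_iff_isNegativeCoupling hσ h (hgr s hs) (hgr s' hs')).2
      (isNegativeCoupling_of_le _ _ (chartForm_symm hσ (hgr s hs)) (chartForm_symm hσ (hgr s' hs'))
        heq.1 heq.2 hle'), heq.1, heq.2, sub_self, mul_zero]
  · have h1 : sigPos (chartForm σ (S s)).toQuadraticMap +
        sigNeg (chartForm σ (S s')).toQuadraticMap + 1 ≤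
        sigPos (chartForm σ (S s')).toQuadraticMap +
        sigNeg (chartForm σ (S s)).toQuadraticMap := by omega
    have h2 : (sigPos (chartForm σ (S s)).toQuadraticMap : ℝ) +
        sigNeg (chartForm σ (S s')).toQuadraticMap + 1 ≤
        sigPos (chartForm σ (S s')).toQuadraticMap +
        sigNeg (chartForm σ (S s)).toQuadraticMap := by exact_mod_cast h1
    refine hind.trans (le_mul_of_one_le_right hC ?_)
    linarith

/-- Only pairs straddling b need a new estimate, and an upward jump of 2 dim V at b bounds any
index. -/
theorem IsIndexControlled.trans {L : ℝ → LagrangianGrassmannian σ} {a b c : ℝ}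
    (h₁ : IsIndexControlled M L a b) (h₂ : IsIndexControlled M L b c) :
    IsIndexControlled M L a c := by
  obtain ⟨g₁, hg₁⟩ := h₁
  obtain ⟨g₂, hg₂⟩ := h₂
  have m₁ : ∀ s, a ≤ s → s ≤ b → g₁ s ≤ g₁ b := by
    intro s hs hsb
    rcases hsb.eq_or_lt with rfl | hlt
    · exact le_rfl
    · linarith [hg₁ s b hs hlt le_rfl, maslovIndex_nonneg M (L s) (L b)]
  have m₂ : ∀ s, b ≤ s → s ≤ c → g₂ b ≤ g₂ s := by
    intro s hs hsb
    rcases hs.eq_or_lt with rfl | hlt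
    · exact le_rfl
    · linarith [hg₂ b s le_rfl hlt hsb, maslovIndex_nonneg M (L b) (L s)]
  refine ⟨fun s => if s < b then g₁ s else g₂ s + (g₁ b - g₂ b + 2 * finrank ℝ V), ?_⟩
  intro s s' has hss' hsc
  by_cases h' : s' < b
  · simp only [if_pos h', if_pos (hss'.trans h')]
    exact hg₁ s s' has hss' h'.le
  · by_cases h : s < b
    · simp only [if_pos h, if_neg h']
      linarith [m₁ s has h.le, m₂ s' (not_lt.1 h') hsc, maslovIndex_le M (L s) (L s')]
    · simp only [if_neg h, if_neg h']
      linarith [hg₂ s s' (not_lt.1 h) hss' hsc]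

theorem isIndexControlled_of_isMonotoneIncreasingOn (hσ : IsSymplectic σ) {T : ℝ} (hT : 0 ≤ T)
    {L : ℝ → LagrangianGrassmannian σ} (hL : CurveDifferentiableOn L (Icc 0 T))
    (hmono : IsMonotoneIncreasingOn L (Icc 0 T)) (M : LagrangianGrassmannian σ) :
    IsIndexControlled M L 0 T := by
  have hP : ∀ t : Icc (0 : ℝ) T, ∃ P : LagrangianGrassmannian σ,
      IsCompl M.toSubmodule P.toSubmodule ∧ IsCompl (L t).toSubmodule P.toSubmodule := by
    intro t
    -- The complement varies with t, but the chart domain stays M, as the index criterion requires.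
    obtain ⟨P, hP⟩ := exists_common_isCompl hσ ![M, L t]
    exact ⟨P, hP 0, hP 1⟩
  choose P hMP hLP using hP
  let c : Icc (0 : ℝ) T → Set (Icc (0 : ℝ) T) := fun t =>
    {s | IsCompl (L s).toSubmodule (P t).toSubmodule}
  have hc : ∀ t, IsOpen (c t) := by
    intro t
    rw [isOpen_iff_mem_nhds]
    -- A chart at s contains all nearby planes of the curve, and every graph over M is transversal
    -- to `P t`.
    intro s hs
    obtain ⟨R, -, hR⟩ := (hL s s.2).exists_chart s.2 (hMP t) hs
    rw [← map_nhds_subtype_val] at hR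
    filter_upwards [eventually_map.1 hR] with s' hs'
    change IsCompl (L s').toSubmodule (P t).toSubmodule
    rw [hs']
    exact isCompl_graphOver (hMP t) _
  obtain ⟨u, hu0, humono, ⟨n, hn⟩, hu⟩ := exists_monotone_Icc_subset_open_cover_Icc hT hc
    (fun t _ => mem_iUnion.2 ⟨t, hLP t⟩)
  have hstep : ∀ k, IsIndexControlled M L (u k) (u (k + 1)) := by
    intro k
    obtain ⟨t, ht⟩ := hu k
    have hsub : Icc (u k : ℝ) (u (k + 1)) ⊆ Icc 0 T :=
      Icc_subset_Icc (u k).2.1 (u (k + 1)).2.2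
    exact isIndexControlled_of_isCompl hσ hL hmono (hMP t) hsub fun s hs =>
      ht (show (⟨s, hsub hs⟩ : Icc (0 : ℝ) T) ∈ Icc (u k) (u (k + 1)) from hs)
  have hall : ∀ k, IsIndexControlled M L 0 (u k) := by
    intro k
    induction k with
    | zero =>
      rw [hu0]
      exact ⟨0, fun s s' h1 h2 h3 => absurd (h2.trans_le h3) (not_lt.2 h1)⟩
    | succ k ih => exact ih.trans (hstep k)
  have := hall n
  rwa [hn n le_rfl] at this

theorem sum_succ_sub_castSucc (n : ℕ) (f : Fin (n + 1) → ℝ) :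
    ∑ i : Fin n, (f i.succ - f i.castSucc) = f (Fin.last n) - f 0 := by
  rw [Finset.sum_sub_distrib]
  linarith [Fin.sum_univ_succ f, Fin.sum_univ_castSucc f]

omit [FiniteDimensional ℝ V] in
theorem curveIndex_lt_top_of_isIndexControlled {T : ℝ} {L : ℝ → LagrangianGrassmannian σ}
    (h : IsIndexControlled M L 0 T) : curveIndex M L T < ⊤ := by
  obtain ⟨g, hg⟩ := h
  refine lt_of_le_of_lt (iSup_le fun D => ?_) (EReal.coe_lt_top (g T - g 0))
  rw [EReal.coe_le_coe_iff]
  unfold partitionIndex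
  calc _ ≤ ∑ i : Fin D.N, (g (D.pts i.succ) - g (D.pts i.castSucc)) := by
        refine Finset.sum_le_sum fun i _ => hg _ _ ?_ (D.strictMono i.castSucc_lt_succ) ?_
        · rw [← D.first]; exact D.strictMono.monotone (Fin.zero_le _)
        · exact (D.strictMono.monotone (Fin.le_last _)).trans D.last.le
    _ = g (D.pts (Fin.last D.N)) - g (D.pts 0) :=
        sum_succ_sub_castSucc D.N fun i => g (D.pts i)
    _ = g T - g 0 := by rw [D.first, D.last]

end Increasing

/-! ### Long chains of times near a point with negative derivative. -/

section Accumulation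

/-- A relation that holds eventually after each of the eventual points has infinite chains on which
a given finitely-valued function is constant. -/
theorem exists_chain_of_eventually {ι : Type*} [Finite ι] {l : Filter ℝ} [l.NeBot]
    {A : ℝ → Prop} {r : ℝ → ℝ → Prop} (κ : ℝ → ι) (hA : ∀ᶠ s in l, A s)
    (hr : ∀ s, A s → ∀ᶠ s' in l, r s s') :
    ∃ (u : ℕ → ℝ) (v : ι), ∀ k, A (u k) ∧ κ (u k) = v ∧ r (u k) (u (k + 1)) := by
  -- Pigeonhole: one of the finitely many values occurs frequently, so the next point of the chain
  -- can always be taken with that value.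
  obtain ⟨v, hv⟩ : ∃ v, ∃ᶠ s in l, κ s = v := by
    by_contra! hcon
    obtain ⟨s, hs⟩ := (eventually_all.2 hcon).exists
    exact hs (κ s) rfl
  have hnext : ∀ s : {s // A s ∧ κ s = v}, ∃ s' : {s // A s ∧ κ s = v}, r s s' := by
    rintro ⟨s, hs, -⟩
    obtain ⟨s', h₁, h₂, h₃⟩ := (hv.and_eventually (hA.and (hr s hs))).exists
    exact ⟨⟨s', h₂, h₁⟩, h₃⟩
  obtain ⟨s₀, h₁, h₂⟩ := (hv.and_eventually hA).exists
  choose next hn using hnext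
  let u : ℕ → {s // A s ∧ κ s = v} := fun k => next^[k] ⟨s₀, h₂, h₁⟩
  refine ⟨fun k => u k, v, fun k => ⟨(u k).2.1, (u k).2.2, ?_⟩⟩
  have : u (k + 1) = next (u k) := Function.iterate_succ_apply' next k _
  beta_reduce
  rw [this]
  exact hn _

/-- Near a point with negative derivative, a function decreases along arbitrarily long increasing
sequences, on which a given finitely-valued function is constant. -/
theorem exists_strictMono_of_hasDerivWithinAt_neg {ι : Type*} [Finite ι] {T t c : ℝ} (hT : 0 < T)
    (ht : t ∈ Icc 0 T) {φ : ℝ → ℝ} (hφ : HasDerivWithinAt φ c (Icc 0 T) t) (hc : c < 0)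
    (κ : ℝ → ι) {G : ℝ → Prop} (hG : ∀ᶠ s in 𝓝[Icc 0 T] t, G s) (N : ℕ) :
    ∃ (w : ℕ → ℝ) (v : ι), (∀ k ≤ N, w k ∈ Ioo 0 T ∧ G (w k) ∧ κ (w k) = v) ∧
      ∀ k < N, w k < w (k + 1) ∧ φ (w (k + 1)) < φ (w k) := by
  have hslope : ∀ᶠ s in 𝓝[Icc 0 T \ {t}] t, slope φ t s < 0 :=
    (hasDerivWithinAt_iff_tendsto_slope.1 hφ).eventually_lt_const hc
  rcases ht.2.lt_or_eq with htT | rfl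
  · have hsub : Ioo t T ⊆ Icc 0 T \ {t} := fun s hs =>
      ⟨⟨ht.1.trans hs.1.le, hs.2.le⟩, hs.1.ne'⟩
    have hle : 𝓝[>] t ≤ 𝓝[Icc 0 T \ {t}] t := by
      rw [← nhdsWithin_Ioo_eq_nhdsGT htT]
      exact nhdsWithin_mono _ hsub
    have hle' : 𝓝[>] t ≤ 𝓝[Icc 0 T] t := hle.trans (nhdsWithin_mono _ sdiff_subset)
    have hcont : Tendsto φ (𝓝[>] t) (𝓝 (φ t)) := hφ.continuousWithinAt.mono_left hle'
    obtain ⟨u, v, hu⟩ := exists_chain_of_eventually (l := 𝓝[>] t)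
      (A := fun s => s ∈ Ioo t T ∧ G s ∧ φ s < φ t) (r := fun s s' => s' < s ∧ φ s < φ s') κ
      (by
        filter_upwards [Ioo_mem_nhdsGT htT, hle hslope, hle' hG] with s h₁ h₂ h₃
        refine ⟨h₁, h₃, ?_⟩
        rw [slope_def_field, div_neg_iff] at h₂
        rcases h₂ with h₂ | h₂ <;> linarith [h₁.1])
      (by
        rintro s ⟨hs, -, hsφ⟩
        exact (eventually_nhdsWithin_of_eventually_nhds (eventually_lt_nhds hs.1)).and
          (hcont.eventually_const_lt hsφ))
    -- To the right of t the chain moves back towards t while φ rises towards φ t; reversing its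
    -- first N + 1 points gives increasing times and decreasing values. For t = T, the chain
    -- approaching from the left needs no reversal.
    refine ⟨fun k => u (N - k), v, fun k _ => ?_, fun k hk => ?_⟩
    · obtain ⟨⟨h₁, h₂, -⟩, h₃, -⟩ := hu (N - k)
      exact ⟨⟨ht.1.trans_lt h₁.1, h₁.2⟩, h₂, h₃⟩
    · have := (hu (N - (k + 1))).2.2
      rwa [show N - (k + 1) + 1 = N - k by omega] at this
  · have hsub : Ioo 0 t ⊆ Icc 0 t \ {t} := fun s hs => ⟨⟨hs.1.le, hs.2.le⟩, hs.2.ne⟩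
    have hle : 𝓝[<] t ≤ 𝓝[Icc 0 t \ {t}] t := by
      rw [← nhdsWithin_Ioo_eq_nhdsLT hT]
      exact nhdsWithin_mono _ hsub
    have hle' : 𝓝[<] t ≤ 𝓝[Icc 0 t] t := hle.trans (nhdsWithin_mono _ sdiff_subset)
    have hcont : Tendsto φ (𝓝[<] t) (𝓝 (φ t)) := hφ.continuousWithinAt.mono_left hle'
    obtain ⟨u, v, hu⟩ := exists_chain_of_eventually (l := 𝓝[<] t)
      (A := fun s => s ∈ Ioo 0 t ∧ G s ∧ φ t < φ s) (r := fun s s' => s < s' ∧ φ s' < φ s) κ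
      (by
        filter_upwards [Ioo_mem_nhdsLT hT, hle hslope, hle' hG] with s h₁ h₂ h₃
        refine ⟨h₁, h₃, ?_⟩
        rw [slope_def_field, div_neg_iff] at h₂
        rcases h₂ with h₂ | h₂ <;> linarith [h₁.2])
      (by
        rintro s ⟨hs, -, hsφ⟩
        exact (eventually_nhdsWithin_of_eventually_nhds (eventually_gt_nhds hs.2)).and
          (hcont.eventually_lt_const hsφ))
    exact ⟨u, v, fun k _ => ⟨(hu k).1.1, (hu k).1.2.1, (hu k).2.1⟩, fun k _ => (hu k).2.2⟩

end Accumulation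

/-! ### Finite index forces a nonnegative velocity. -/

section Decreasing

variable {V : Type*} [NormedAddCommGroup V] [NormedSpace ℝ V] [FiniteDimensional ℝ V]
  {σ : LinearMap.BilinForm ℝ V}

open Module

omit [FiniteDimensional ℝ V] in
/-- The sum of the indices along a chain of interior points is bounded by the index of a
partition. -/
theorem exists_sum_le_partitionIndex (M : LagrangianGrassmannian σ)
    (L : ℝ → LagrangianGrassmannian σ) {T : ℝ} {N : ℕ} {w : ℕ → ℝ}
    (hw : ∀ k ≤ N, w k ∈ Ioo 0 T) (hlt : ∀ k < N, w k < w (k + 1)) :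
    ∃ D : IntervalPartition T,
      ∑ k ∈ Finset.range N, maslovIndex M (L (w k)) (L (w (k + 1))) ≤ partitionIndex M L D := by
  -- The N + 1 chain points are padded by the end points 0 and T; the two extra intervals contribute
  -- nonnegative indices.
  let v : ℕ → ℝ := fun k => if k = 0 then 0 else if k ≤ N + 1 then w (k - 1) else T
  have hv0 : v 0 = 0 := rfl
  have hvw : ∀ k ≤ N, v (k + 1) = w k := fun k hk => by
    simp only [v, if_neg (Nat.succ_ne_zero k), if_pos (Nat.succ_le_succ hk), Nat.add_sub_cancel]
  have hvT : v (N + 2) = T := by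
    simp [v]
  let D : IntervalPartition T :=
    { N := N + 2
      pts := fun i => v i
      strictMono := by
        rw [Fin.strictMono_iff_lt_succ]
        intro i
        change v i < v (i + 1)
        obtain ⟨i, hi⟩ := i
        change v i < v (i + 1)
        rcases i with _ | i
        · rw [hv0, hvw 0 (Nat.zero_le _)]
          exact (hw 0 (Nat.zero_le _)).1
        · rcases Nat.lt_or_ge i N with h | h
          · rw [hvw i h.le, hvw (i + 1) h]
            exact hlt i h
          · obtain rfl : i = N := by omega
            rw [hvw i le_rfl, hvT]
            exact (hw i le_rfl).2
      first := rfl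
      last := hvT }
  refine ⟨D, ?_⟩
  have hD : partitionIndex M L D =
      ∑ k ∈ Finset.range (N + 2), maslovIndex M (L (v k)) (L (v (k + 1))) :=
    Fin.sum_univ_eq_sum_range (fun k => maslovIndex M (L (v k)) (L (v (k + 1)))) (N + 2)
  rw [hD, Finset.sum_range_succ, Finset.sum_range_succ']
  have hsum : ∑ k ∈ Finset.range N, maslovIndex M (L (w k)) (L (w (k + 1))) =
      ∑ k ∈ Finset.range N, maslovIndex M (L (v (k + 1))) (L (v (k + 1 + 1))) := by
    refine Finset.sum_congr rfl fun k hk => ?_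
    have hk' := Finset.mem_range.1 hk
    rw [hvw k hk'.le, hvw (k + 1) hk']
  rw [hsum]
  linarith [maslovIndex_nonneg M (L (v 0)) (L (v (0 + 1))),
    maslovIndex_nonneg M (L (v (N + 1))) (L (v (N + 1 + 1)))]

theorem nonneg_velocityForm_of_curveIndex_lt_top (hσ : IsSymplectic σ) {T : ℝ} (hT : 0 < T)
    {L : ℝ → LagrangianGrassmannian σ} (hL : CurveDifferentiableOn L (Icc 0 T))
    {M : LagrangianGrassmannian σ} (hM : curveIndex M L T < ⊤) {t : ℝ} (ht : t ∈ Icc 0 T)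
    {q : QuadraticForm ℝ (L t).toSubmodule} (hq : IsVelocityForm L (Icc 0 T) t q)
    (x : (L t).toSubmodule) : 0 ≤ q x := by
  by_contra! hneg
  obtain ⟨P, hP⟩ := exists_common_isCompl hσ ![M, L t]
  have hMP : IsCompl M.toSubmodule P.toSubmodule := hP 0
  obtain ⟨S, hS, hgr⟩ := (hL t ht).exists_chart ht hMP (hP 1)
  obtain ⟨S', hS'⟩ : ∃ S', HasDerivWithinAt S S' (Icc 0 T) t :=
    ⟨_, HasFDerivWithinAt.hasDerivWithinAt (DifferentiableWithinAt.hasFDerivWithinAt hS)⟩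
  have hx : (x : V) ∈ graphOver (S t) := (hgr.self_of_nhdsWithin ht).le x.2
  obtain ⟨a, ha⟩ := mem_graphOver.1 hx
  rw [hq.apply_chart ht hS' hgr a x ha.symm] at hneg
  -- The pair (ind⁺, ind⁻) takes finitely many values, so the chain can be chosen with constant
  -- signature.
  let κ : ℝ → Fin (finrank ℝ M.toSubmodule + 1) × Fin (finrank ℝ M.toSubmodule + 1) := fun s =>
    (⟨sigPos (chartForm σ (S s)).toQuadraticMap, Nat.lt_succ_of_le (sigPos_le_finrank _)⟩,
      ⟨sigNeg (chartForm σ (S s)).toQuadraticMap, Nat.lt_succ_of_le (sigPos_le_finrank _)⟩)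
  obtain ⟨C, hC, -⟩ := EReal.lt_iff_exists_real_btwn.1 hM
  -- N steps of index at least 1/2 exceed the bound C.
  obtain ⟨N, hN⟩ := exists_nat_gt (2 * C)
  obtain ⟨w, v, hw, hlt⟩ := exists_strictMono_of_hasDerivWithinAt_neg hT ht
    (hasDerivWithinAt_chartForm hS' a) hneg κ hgr N
  obtain ⟨D, hD⟩ := exists_sum_le_partitionIndex M L (fun k hk => (hw k hk).1)
    (fun k hk => (hlt k hk).1)
  have hDC : partitionIndex M L D < C := by
    rw [← EReal.coe_lt_coe_iff]
    exact (le_iSup (fun D : IntervalPartition T => ((partitionIndex M L D : ℝ) : EReal)) D).trans_lt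
      hC
  have hterm : ∀ k ∈ Finset.range N, 1 / 2 ≤ maslovIndex M (L (w k)) (L (w (k + 1))) := by
    intro k hk
    have hk' := Finset.mem_range.1 hk
    obtain ⟨-, hg, hκ⟩ := hw k hk'.le
    obtain ⟨-, hg', hκ'⟩ := hw (k + 1) hk'
    have hκκ : κ (w k) = κ (w (k + 1)) := hκ.trans hκ'.symm
    -- Zero index at equal signatures would make the chart form at `w (k + 1)` dominate the one at
    -- `w k`, contradicting the decrease at a.
    refine half_le_maslovIndex _ _ _ fun h0 => ?_
    rw [maslovIndex_eq_zero_iff_isNegativeCoupling hσ hMP hg hg'] at h0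
    exact (hlt k hk').2.not_ge (le_of_isNegativeCoupling _ _ (chartForm_symm hσ hg)
      (chartForm_symm hσ hg') (congrArg (fun z => (z.1 : ℕ)) hκκ)
      (congrArg (fun z => (z.2 : ℕ)) hκκ) h0 a)
  have hsum := Finset.card_nsmul_le_sum (Finset.range N) _ _ hterm
  rw [Finset.card_range, nsmul_eq_mul] at hsum
  linarith

end Decreasing

end MaslovMonotone

theorem mainTheorem8 {V : Type*} [NormedAddCommGroup V] [NormedSpace ℝ V]
    [FiniteDimensional ℝ V] (σ : LinearMap.BilinForm ℝ V) (hσ : MaslovMonotone.IsSymplectic σ)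
    (T : ℝ) (hT : 0 < T) (L : ℝ → MaslovMonotone.LagrangianGrassmannian σ)
    (hL : MaslovMonotone.CurveDifferentiableOn L (Set.Icc 0 T)) :
    MaslovMonotone.IsMonotoneIncreasingOn L (Set.Icc 0 T) ↔
      ∃ P : MaslovMonotone.LagrangianGrassmannian σ, MaslovMonotone.curveIndex P L T < ⊤ := by
  constructor
  · intro hmono
    -- For a monotone curve every reference plane works; `L 0` is merely one at hand.
    exact ⟨L 0, MaslovMonotone.curveIndex_lt_top_of_isIndexControlled
      (MaslovMonotone.isIndexControlled_of_isMonotoneIncreasingOn hσ hT.le hL hmono (L 0))⟩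
  · rintro ⟨P, hP⟩ t ht
    obtain ⟨q, hq, -⟩ := MaslovMonotone.existsUnique_isVelocityForm L (Set.Icc 0 T) t ht
      (uniqueDiffOn_Icc hT t ht) (hL t ht)
    exact ⟨q, hq, MaslovMonotone.nonneg_velocityForm_of_curveIndex_lt_top hσ hT hL hP ht hq⟩
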